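/- All sequences are complex and $\omega=\mathbb C^{\mathbb N}$ has the topology of pointwise convergence. A finite set $A=\{n_1<\dots<n_k\}\subset\mathbb N=\{1,2,\dots\}$ is admissible if $k\le n_1$. The Schreier space $\mathcal S$ is the completion of $c_{00}$ in the norm $\|x\|_{\mathcal S}=\sup_A\sum_{j\in A}|x_j|$ ($A$ admissible), realized in $\omega$; its 2-convexification is $\mathcal S^2=\{x\in\omega:|x|^2\in\mathcal S\}$ with $\|x\|_{\mathcal S^2}=\||x|^2\|_{\mathcal S}^{1/2}$. The dual $(\mathcal S^2)^*$ is regarded as a space of sequences through $\varphi\mapsto(\varphi(e_j))_j$. For Banach spaces $X_0,X_1$ continuously included in $\omega$, let $\mathcal F_\infty(X_0,X_1)$ be the space of functions $F:\{0\le\operatorname{Re}z\le1\}\to\omega$ that are (coordinatewise) bounded and continuous, analytic for $0<\operatorname{Re}z<1$, and such that $t\mapsto F(k+it)$ is a bounded continuous function $\mathbb R\to X_k$ for $k=0,1$, with $\|F\|=\max_{k}\sup_t\|F(k+it)\|_{X_k}$. The derived space $Z(\mathcal S^2)$ consists of the couples $(x,y)\in\omega\times\omega$ for which there is $F\in\mathcal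 F_\infty(\mathcal S^2,(\mathcal S^2)^*)$ with $F(1/2)=y$ and $F'(1/2)=x$, normed by the infimum of $\|F\|$ over all such $F$. The Kalton–Peck space $Z_2$ is the space of couples $(x,y)\in\omega\times\omega$ with $y\in\ell_2$ and $x-\Omega(y)\in\ell_2$, with the quasi-norm $\|(x,y)\|_{Z_2}=\|x-\Omega(y)\|_2+\|y\|_2$, where $\Omega(y)_j=y_j\log(|y_j|/\|y\|_2)$ (and $0\log 0=0$, $\Omega(0)=0$). For $n\ge1$ let $u_n=2^{\frac{1-n}{2}}\sum_{j=2^{n-1}}^{2^n-1}e_j$. **Lemma 4.2.** The space $Z(\mathcal S^2)$ contains an isomorphic copy of $Z_2$, namely the closed linear span of the vectors $(u_n,0)$, $(0,u_n)$, $n\ge1$. That is, all these vectors belong to $Z(\mathcal S^2)$, and there are a linear map $T:Z_2\to Z(\mathcal S^2)$ and constants $c,C>0$ with $c\|v\|_{Z_2}\le\|Tv\|_{Z(\mathcal S^2)}\le C\|v\|_{Z_2}$ for all $v\in Z_2$, whose range is the closed linear span of $\{(u_n,0),(0,u_n):n\ge1\}$ in $Z(\mathcal S^2)$. -/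

import Mathlib

/-! Complex sequences are functions `ℕ → ℂ` with the topology of pointwise convergence.
The index `j : ℕ` stands for the `(j + 1)`-st coordinate, so that coordinates `1, 2, 3, …`
correspond to `j = 0, 1, 2, …`. -/

namespace TwistedHilbert

open scoped ENNReal BoundedContinuousFunction

/-! ### The derived space of an interpolation couple -/

section Derived

variable {X₀ X₁ : Type*} [NormedAddCommGroup X₀] [NormedSpace ℂ X₀]
  [NormedAddCommGroup X₁] [NormedSpace ℂ X₁]

/-- `F`, with boundary values `g₀` (on `Re z = 0`) and `g₁` (on `Re z = 1`), belongs to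
`𝓕_∞(X₀, X₁)`. The spaces `X₀`, `X₁` are regarded as spaces of sequences through the continuous
inclusions `ι₀`, `ι₁`. Boundedness in the space of all sequences is boundedness of every
coordinate. -/
structure MemF (ι₀ : X₀ →L[ℂ] (ℕ → ℂ)) (ι₁ : X₁ →L[ℂ] (ℕ → ℂ))
    (F : ℂ → ℕ → ℂ) (g₀ : ℝ →ᵇ X₀) (g₁ : ℝ →ᵇ X₁) : Prop where
  continuousOn : ContinuousOn F (Complex.re ⁻¹' Set.Icc 0 1)
  bounded : ∀ j, ∃ C : ℝ, ∀ z ∈ Complex.re ⁻¹' Set.Icc (0 : ℝ) 1, ‖F z j‖ ≤ C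
  analytic : ∀ j, DifferentiableOn ℂ (fun z => F z j) (Complex.re ⁻¹' Set.Ioo 0 1)
  left : ∀ t : ℝ, F (t * Complex.I) = ι₀ (g₀ t)
  right : ∀ t : ℝ, F (1 + t * Complex.I) = ι₁ (g₁ t)

/-- `F ∈ 𝓕_∞(X₀, X₁)`, with boundary values `g₀`, `g₁`, represents the couple `v = (x, y)`:
`F (1/2) = y` and `F' (1/2) = x`. -/
structure Represents (ι₀ : X₀ →L[ℂ] (ℕ → ℂ)) (ι₁ : X₁ →L[ℂ] (ℕ → ℂ))
    (v : (ℕ → ℂ) × (ℕ → ℂ)) (F : ℂ → ℕ → ℂ) (g₀ : ℝ →ᵇ X₀) (g₁ : ℝ →ᵇ X₁) : Prop where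
  mem : MemF ι₀ ι₁ F g₀ g₁
  value : F (1 / 2) = v.2
  deriv : ∀ j, HasDerivAt (fun z => F z j) (v.1 j) (1 / 2)

variable {ι₀ : X₀ →L[ℂ] (ℕ → ℂ)} {ι₁ : X₁ →L[ℂ] (ℕ → ℂ)}
  {v w : (ℕ → ℂ) × (ℕ → ℂ)} {F G : ℂ → ℕ → ℂ} {g₀ h₀ : ℝ →ᵇ X₀} {g₁ h₁ : ℝ →ᵇ X₁}

theorem represents_zero : Represents ι₀ ι₁ 0 0 0 0 where
  mem :=
    { continuousOn := continuousOn_const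
      bounded := fun j => ⟨0, fun z _ => by simp⟩
      analytic := fun j => differentiableOn_const (0 : ℂ)
      left := fun t => by simp
      right := fun t => by simp }
  value := rfl
  deriv := fun j => hasDerivAt_const (1 / 2 : ℂ) (0 : ℂ)

theorem Represents.add (h : Represents ι₀ ι₁ v F g₀ g₁) (k : Represents ι₀ ι₁ w G h₀ h₁) :
    Represents ι₀ ι₁ (v + w) (F + G) (g₀ + h₀) (g₁ + h₁) where
  mem :=
    { continuousOn := h.mem.continuousOn.add k.mem.continuousOn
      bounded := fun j => by
        obtain ⟨C, hC⟩ := h.mem.bounded j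
        obtain ⟨D, hD⟩ := k.mem.bounded j
        exact ⟨C + D, fun z hz => (norm_add_le _ _).trans (add_le_add (hC z hz) (hD z hz))⟩
      analytic := fun j => (h.mem.analytic j).add (k.mem.analytic j)
      left := fun t => by simp [h.mem.left, k.mem.left]
      right := fun t => by simp [h.mem.right, k.mem.right] }
  value := congrArg₂ (· + ·) h.value k.value
  deriv := fun j => (h.deriv j).add (k.deriv j)

theorem Represents.smul (h : Represents ι₀ ι₁ v F g₀ g₁) (c : ℂ) :
    Represents ι₀ ι₁ (c • v) (c • F) (c • g₀) (c • g₁) where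
  mem :=
    { continuousOn := h.mem.continuousOn.const_smul c
      bounded := fun j => by
        obtain ⟨C, hC⟩ := h.mem.bounded j
        refine ⟨‖c‖ * C, fun z hz => ?_⟩
        simpa using mul_le_mul_of_nonneg_left (hC z hz) (norm_nonneg c)
      analytic := fun j => (h.mem.analytic j).const_smul c
      left := fun t => by simp [h.mem.left]
      right := fun t => by simp [h.mem.right] }
  value := congrArg (c • ·) h.value
  deriv := fun j => (h.deriv j).const_smul c

variable (ι₀ ι₁) in
/-- The couples `(x, y)` of sequences that are represented by some `F ∈ 𝓕_∞(X₀, X₁)`. -/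
def derivedSubmodule : Submodule ℂ ((ℕ → ℂ) × (ℕ → ℂ)) where
  carrier := {v | ∃ F g₀ g₁, Represents ι₀ ι₁ v F g₀ g₁}
  zero_mem' := ⟨0, 0, 0, represents_zero⟩
  add_mem' := by
    rintro v w ⟨F, g₀, g₁, h⟩ ⟨G, h₀, h₁, k⟩
    exact ⟨_, _, _, h.add k⟩
  smul_mem' := by
    rintro c v ⟨F, g₀, g₁, h⟩
    exact ⟨_, _, _, h.smul c⟩

variable (ι₀ ι₁) in
/-- The derived space of `(X₀, X₁)_{1/2}`: the couples `(x, y)` of sequences that are represented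
by some `F ∈ 𝓕_∞(X₀, X₁)`, with the norm `inf {‖F‖ : F (1/2) = y, F' (1/2) = x}`, where `‖F‖` is
the larger of the suprema of `‖F (it)‖_{X₀}` and of `‖F (1 + it)‖_{X₁}`. -/
def DerivedSpace : Type := ↥(derivedSubmodule ι₀ ι₁)

namespace DerivedSpace

instance : AddCommGroup (DerivedSpace ι₀ ι₁) :=
  inferInstanceAs (AddCommGroup ↥(derivedSubmodule ι₀ ι₁))

instance : Module ℂ (DerivedSpace ι₀ ι₁) :=
  inferInstanceAs (Module ℂ ↥(derivedSubmodule ι₀ ι₁))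

/-- The couple of sequences underlying an element of the derived space. -/
def toPair : DerivedSpace ι₀ ι₁ →ₗ[ℂ] (ℕ → ℂ) × (ℕ → ℂ) := (derivedSubmodule ι₀ ι₁).subtype

noncomputable instance : Norm (DerivedSpace ι₀ ι₁) where
  norm v := sInf {r : ℝ | ∃ F g₀ g₁, Represents ι₀ ι₁ v.toPair F g₀ g₁ ∧ r = max ‖g₀‖ ‖g₁‖}

theorem toPair_injective : Function.Injective (toPair : DerivedSpace ι₀ ι₁ → _) :=
  Subtype.val_injective

theorem norm_le (v : DerivedSpace ι₀ ι₁) (h : Represents ι₀ ι₁ v.toPair F g₀ g₁) :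
    ‖v‖ ≤ max ‖g₀‖ ‖g₁‖ := by
  refine csInf_le ⟨0, ?_⟩ ⟨F, g₀, g₁, h, rfl⟩
  rintro r ⟨F, g₀, g₁, -, rfl⟩
  exact le_max_of_le_left (norm_nonneg _)

theorem exists_lt (v : DerivedSpace ι₀ ι₁) {ε : ℝ} (hε : 0 < ε) :
    ∃ F g₀ g₁, Represents ι₀ ι₁ v.toPair F g₀ g₁ ∧ max ‖g₀‖ ‖g₁‖ < ‖v‖ + ε := by
  obtain ⟨F, g₀, g₁, h⟩ := v.2
  obtain ⟨r, ⟨F, g₀, g₁, h, rfl⟩, hr⟩ := exists_lt_of_csInf_lt (s := {r : ℝ | ∃ F g₀ g₁,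
    Represents ι₀ ι₁ v.toPair F g₀ g₁ ∧ r = max ‖g₀‖ ‖g₁‖}) ⟨_, F, g₀, g₁, h, rfl⟩
    (lt_add_of_pos_right ‖v‖ hε)
  exact ⟨F, g₀, g₁, h, hr⟩

end DerivedSpace

/-- Three lines theorem for the coordinates of `F ∈ 𝓕_∞(X₀, X₁)`. -/
theorem MemF.coord_le (h : MemF ι₀ ι₁ F g₀ g₁) (j : ℕ) {M : ℝ}
    (h₀ : ∀ x, ‖ι₀ x j‖ ≤ M * ‖x‖) (h₁ : ∀ x, ‖ι₁ x j‖ ≤ M * ‖x‖) (hM : 0 ≤ M)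
    {z : ℂ} (hz : z ∈ Complex.re ⁻¹' Set.Icc (0 : ℝ) 1) :
    ‖F z j‖ ≤ M * max ‖g₀‖ ‖g₁‖ := by
  have hB : 0 ≤ M * max ‖g₀‖ ‖g₁‖ := mul_nonneg hM (le_max_of_le_left (norm_nonneg _))
  have hcl : closure (Complex.HadamardThreeLines.verticalStrip 0 1)
      = Complex.re ⁻¹' Set.Icc (0 : ℝ) 1 := by
    rw [Complex.HadamardThreeLines.verticalStrip, ← closure_Ioo (zero_ne_one' ℝ)]
    exact (Complex.closure_preimage_re _)
  have key := Complex.HadamardThreeLines.norm_le_interp_of_mem_verticalClosedStrip₀₁'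
    (fun z => F z j) (z := z) (a := M * max ‖g₀‖ ‖g₁‖) (b := M * max ‖g₀‖ ‖g₁‖) hz
    ⟨h.analytic j, by
      rw [hcl]
      exact (continuous_apply j).comp_continuousOn h.continuousOn⟩
    (by
      obtain ⟨C, hC⟩ := h.bounded j
      refine ⟨C, ?_⟩
      rintro _ ⟨w, hw, rfl⟩
      exact hC w hw)
    (by
      intro w hw
      have e : w = (w.im : ℂ) * Complex.I := by
        apply Complex.ext <;> simp_all
      rw [e, h.left]
      refine (h₀ _).trans (mul_le_mul_of_nonneg_left ?_ hM)
      exact (g₀.norm_coe_le_norm _).trans (le_max_left _ _))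
    (by
      intro w hw
      have e : w = 1 + (w.im : ℂ) * Complex.I := by
        apply Complex.ext <;> simp_all
      rw [e, h.right]
      refine (h₁ _).trans (mul_le_mul_of_nonneg_left ?_ hM)
      exact (g₁.norm_coe_le_norm _).trans (le_max_right _ _))
  refine key.trans ?_
  rcases hB.eq_or_lt with h0 | h0
  · rw [← h0]
    rcases eq_or_ne z.re 0 with h1 | h1
    · simp [h1]
    · simp [Real.zero_rpow h1]
  · rw [← Real.rpow_add h0]
    simp

/-- Values and derivatives at `1/2` are controlled coordinatewise by the norm. -/
theorem exists_coord_bound (ι₀ : X₀ →L[ℂ] (ℕ → ℂ)) (ι₁ : X₁ →L[ℂ] (ℕ → ℂ)) (j : ℕ) :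
    ∃ M : ℝ, 0 ≤ M ∧ ∀ v F g₀ g₁, Represents ι₀ ι₁ v F g₀ g₁ →
      ‖v.1 j‖ ≤ M * max ‖g₀‖ ‖g₁‖ ∧ ‖v.2 j‖ ≤ M * max ‖g₀‖ ‖g₁‖ := by
  set p₀ := (ContinuousLinearMap.proj (R := ℂ) (φ := fun _ : ℕ => ℂ) j).comp ι₀
  set p₁ := (ContinuousLinearMap.proj (R := ℂ) (φ := fun _ : ℕ => ℂ) j).comp ι₁
  have hM : 0 ≤ max ‖p₀‖ ‖p₁‖ := le_max_of_le_left (norm_nonneg _)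
  have h₀ : ∀ x, ‖ι₀ x j‖ ≤ max ‖p₀‖ ‖p₁‖ * ‖x‖ := fun x =>
    (p₀.le_opNorm x).trans (mul_le_mul_of_nonneg_right (le_max_left _ _) (norm_nonneg _))
  have h₁ : ∀ x, ‖ι₁ x j‖ ≤ max ‖p₀‖ ‖p₁‖ * ‖x‖ := fun x =>
    (p₁.le_opNorm x).trans (mul_le_mul_of_nonneg_right (le_max_right _ _) (norm_nonneg _))
  refine ⟨4 * max ‖p₀‖ ‖p₁‖, by positivity, fun v F g₀ g₁ h => ?_⟩
  have hB : 0 ≤ max ‖p₀‖ ‖p₁‖ * max ‖g₀‖ ‖g₁‖ :=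
    mul_nonneg hM (le_max_of_le_left (norm_nonneg _))
  have hball : Metric.closedBall (1 / 2 : ℂ) (1 / 4) ⊆ Complex.re ⁻¹' Set.Ioo (0 : ℝ) 1 := by
    intro z hz
    have h1 : |(z - 1 / 2).re| ≤ 1 / 4 :=
      (Complex.abs_re_le_norm _).trans (by simpa [dist_eq_norm] using hz)
    have h2 : (z - 1 / 2).re = z.re - 1 / 2 := by simp
    rw [h2, abs_le] at h1
    constructor <;> linarith [h1.1, h1.2]
  have hsub : Complex.re ⁻¹' Set.Ioo (0 : ℝ) 1 ⊆ Complex.re ⁻¹' Set.Icc (0 : ℝ) 1 :=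
    Set.preimage_mono Set.Ioo_subset_Icc_self
  constructor
  · have := Complex.norm_deriv_le_of_forall_mem_sphere_norm_le (c := 1 / 2) (R := 1 / 4)
      (C := max ‖p₀‖ ‖p₁‖ * max ‖g₀‖ ‖g₁‖) (f := fun z => F z j) (by norm_num)
      (DifferentiableOn.diffContOnCl ((h.mem.analytic j).mono
        (Metric.closure_ball_subset_closedBall.trans hball)))
      (fun z hz => h.mem.coord_le j h₀ h₁ hM (hsub (hball (Metric.sphere_subset_closedBall hz))))
    rw [(h.deriv j).deriv] at this
    linarith
  · have := h.mem.coord_le j h₀ h₁ hM (hsub (hball (Metric.mem_closedBall_self (by norm_num))))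
    rw [h.value] at this
    linarith

namespace DerivedSpace

theorem normedSpaceCore : NormedSpace.Core ℂ (DerivedSpace ι₀ ι₁) where
  norm_nonneg v := by
    refine Real.sInf_nonneg ?_
    rintro r ⟨F, g₀, g₁, -, rfl⟩
    exact le_max_of_le_left (norm_nonneg _)
  norm_smul c v := by
    have key : ∀ (c : ℂ) (v : DerivedSpace ι₀ ι₁), ‖c • v‖ ≤ ‖c‖ * ‖v‖ := by
      intro c v
      refine le_of_forall_pos_le_add fun ε hε => ?_
      have hc : 0 < ‖c‖ + 1 := by positivity
      obtain ⟨F, g₀, g₁, h, hlt⟩ := v.exists_lt (div_pos hε hc)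
      have h2 := (c • v).norm_le (by rw [map_smul]; exact h.smul c)
      rw [norm_smul c g₀, norm_smul c g₁, ← mul_max_of_nonneg _ _ (norm_nonneg c)] at h2
      have h3 : ‖c‖ * (ε / (‖c‖ + 1)) ≤ ε := by
        rw [mul_div_assoc', div_le_iff₀ hc]
        nlinarith
      nlinarith [mul_le_mul_of_nonneg_left hlt.le (norm_nonneg c)]
    refine le_antisymm (key c v) ?_
    rcases eq_or_ne c 0 with rfl | hc
    · have h1 : 0 ≤ ‖(0 : DerivedSpace ι₀ ι₁)‖ := by
        refine Real.sInf_nonneg ?_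
        rintro r ⟨F, g₀, g₁, -, rfl⟩
        exact le_max_of_le_left (norm_nonneg _)
      simpa using h1
    · have h1 := key c⁻¹ (c • v)
      rw [inv_smul_smul₀ hc, norm_inv] at h1
      have hc' : 0 < ‖c‖ := norm_pos_iff.2 hc
      rwa [← div_eq_inv_mul, le_div_iff₀' hc'] at h1
  norm_triangle v w := by
    refine le_of_forall_pos_le_add fun ε hε => ?_
    obtain ⟨F, g₀, g₁, h, hlt⟩ := v.exists_lt (half_pos hε)
    obtain ⟨G, h₀, h₁, k, klt⟩ := w.exists_lt (half_pos hε)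
    have h2 := (v + w).norm_le (by rw [map_add]; exact h.add k)
    have h3 : max ‖g₀ + h₀‖ ‖g₁ + h₁‖ ≤ max ‖g₀‖ ‖g₁‖ + max ‖h₀‖ ‖h₁‖ :=
      max_le ((norm_add_le _ _).trans (add_le_add (le_max_left _ _) (le_max_left _ _)))
        ((norm_add_le _ _).trans (add_le_add (le_max_right _ _) (le_max_right _ _)))
    linarith
  norm_eq_zero_iff v := by
    constructor
    · intro hv
      have hz : ∀ j, v.toPair.1 j = 0 ∧ v.toPair.2 j = 0 := by
        intro j
        obtain ⟨M, hM, hb⟩ := exists_coord_bound ι₀ ι₁ j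
        have hle : ∀ ε > 0, ‖v.toPair.1 j‖ ≤ 0 + ε ∧ ‖v.toPair.2 j‖ ≤ 0 + ε := by
          intro ε hε
          have hc : 0 < M + 1 := by positivity
          obtain ⟨F, g₀, g₁, h, hlt⟩ := v.exists_lt (div_pos hε hc)
          rw [hv, zero_add] at hlt
          have h3 : M * (ε / (M + 1)) ≤ ε := by
            rw [mul_div_assoc', div_le_iff₀ hc]
            nlinarith
          have h4 := mul_le_mul_of_nonneg_left hlt.le hM
          exact ⟨by linarith [(hb _ _ _ _ h).1], by linarith [(hb _ _ _ _ h).2]⟩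
        exact ⟨norm_le_zero_iff.1 (le_of_forall_pos_le_add fun ε hε => (hle ε hε).1),
          norm_le_zero_iff.1 (le_of_forall_pos_le_add fun ε hε => (hle ε hε).2)⟩
      apply toPair_injective
      rw [map_zero]
      exact Prod.ext (funext fun j => (hz j).1) (funext fun j => (hz j).2)
    · rintro rfl
      refine le_antisymm ?_ ?_
      · refine ((0 : DerivedSpace ι₀ ι₁).norm_le
          (by rw [map_zero]; exact represents_zero)).trans ?_
        simp
      · refine Real.sInf_nonneg ?_
        rintro r ⟨F, g₀, g₁, -, rfl⟩
        exact le_max_of_le_left (norm_nonneg _)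

noncomputable instance : NormedAddCommGroup (DerivedSpace ι₀ ι₁) :=
  NormedAddCommGroup.ofCore normedSpaceCore

noncomputable instance : NormedSpace ℂ (DerivedSpace ι₀ ι₁) :=
  NormedSpace.ofCore normedSpaceCore

end DerivedSpace

end Derived

/-! ### The Schreier space and its 2-convexification -/

/-- A finite set `{n₁ < … < n_k}` of positive integers is admissible if `k ≤ n₁`; the index `j`
stands for the integer `j + 1`. -/
def Admissible (A : Finset ℕ) : Prop := ∀ j ∈ A, A.card ≤ j + 1

/-- The Schreier norm `sup_A ∑_{j ∈ A} |x_j|` of an arbitrary sequence (possibly infinite). -/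
noncomputable def schreierENorm (x : ℕ → ℂ) : ℝ≥0∞ :=
  ⨆ (A : Finset ℕ) (_ : Admissible A), ∑ j ∈ A, ‖x j‖ₑ

/-- `x` belongs to the Schreier space, the completion of the finitely supported sequences in the
Schreier norm, realized as a space of sequences. -/
def MemSchreier (x : ℕ → ℂ) : Prop :=
  ∀ ε : ℝ≥0∞, 0 < ε → ∃ y : ℕ → ℂ, y.support.Finite ∧ schreierENorm (x - y) ≤ ε

/-- The sequence `|x|²`. -/
noncomputable def absSq (x : ℕ → ℂ) : ℕ → ℂ := fun j => ((‖x j‖ ^ 2 : ℝ) : ℂ)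

theorem enorm_absSq (x : ℕ → ℂ) (j : ℕ) : ‖absSq x j‖ₑ = ‖x j‖ₑ ^ 2 := by
  rw [absSq, ← ofReal_norm, ← ofReal_norm, Complex.norm_real, Real.norm_of_nonneg (by positivity),
    ENNReal.ofReal_pow (norm_nonneg _)]

theorem sum_le_schreierENorm (x : ℕ → ℂ) {A : Finset ℕ} (hA : Admissible A) :
    ∑ j ∈ A, ‖x j‖ₑ ≤ schreierENorm x :=
  le_iSup₂ (f := fun (A : Finset ℕ) (_ : Admissible A) => ∑ j ∈ A, ‖x j‖ₑ) A hA

theorem schreierENorm_mono {x y : ℕ → ℂ} (h : ∀ j, ‖x j‖ₑ ≤ ‖y j‖ₑ) :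
    schreierENorm x ≤ schreierENorm y :=
  iSup₂_mono fun _ _ => Finset.sum_le_sum fun j _ => h j

theorem schreierENorm_add_le (x y : ℕ → ℂ) :
    schreierENorm (x + y) ≤ schreierENorm x + schreierENorm y := by
  refine iSup₂_le fun A hA => ?_
  calc ∑ j ∈ A, ‖(x + y) j‖ₑ ≤ ∑ j ∈ A, (‖x j‖ₑ + ‖y j‖ₑ) :=
        Finset.sum_le_sum fun j _ => enorm_add_le _ _
    _ = ∑ j ∈ A, ‖x j‖ₑ + ∑ j ∈ A, ‖y j‖ₑ := Finset.sum_add_distrib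
    _ ≤ _ := add_le_add (sum_le_schreierENorm x hA) (sum_le_schreierENorm y hA)

theorem schreierENorm_smul (c : ℂ) (x : ℕ → ℂ) :
    schreierENorm (c • x) = ‖c‖ₑ * schreierENorm x := by
  simp only [schreierENorm, ENNReal.mul_iSup, Finset.mul_sum, Pi.smul_apply, enorm_smul]

theorem MemSchreier.mono {x y : ℕ → ℂ} (hy : MemSchreier y) (h : ∀ j, ‖x j‖ₑ ≤ ‖y j‖ₑ) :
    MemSchreier x := by
  classical
  intro ε hε
  obtain ⟨w, hw, hle⟩ := hy ε hε
  refine ⟨fun j => if w j = 0 then 0 else x j, hw.subset ?_, le_trans ?_ hle⟩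
  · intro j hj h0
    simp [h0] at hj
  · refine schreierENorm_mono fun j => ?_
    by_cases h0 : w j = 0
    · simpa [h0] using h j
    · simp [h0]

theorem MemSchreier.add {x y : ℕ → ℂ} (hx : MemSchreier x) (hy : MemSchreier y) :
    MemSchreier (x + y) := by
  intro ε hε
  obtain ⟨v, hv, hv'⟩ := hx (ε / 2) (ENNReal.half_pos hε.ne')
  obtain ⟨w, hw, hw'⟩ := hy (ε / 2) (ENNReal.half_pos hε.ne')
  refine ⟨v + w, (hv.union hw).subset (Function.support_add _ _), ?_⟩
  calc schreierENorm (x + y - (v + w)) = schreierENorm ((x - v) + (y - w)) := by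
        congr 1; abel
    _ ≤ ε / 2 + ε / 2 := (schreierENorm_add_le _ _).trans (add_le_add hv' hw')
    _ = ε := ENNReal.add_halves ε

theorem MemSchreier.smul {x : ℕ → ℂ} (hx : MemSchreier x) (c : ℂ) : MemSchreier (c • x) := by
  intro ε hε
  obtain ⟨w, hw, hw'⟩ := hx (ε / (‖c‖ₑ + 1)) (ENNReal.div_pos hε.ne' (by finiteness))
  refine ⟨c • w, hw.subset (Function.support_const_smul_subset c w), ?_⟩
  rw [← smul_sub, schreierENorm_smul]
  calc ‖c‖ₑ * schreierENorm (x - w) ≤ (‖c‖ₑ + 1) * (ε / (‖c‖ₑ + 1)) :=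
        mul_le_mul' le_self_add hw'
    _ ≤ ε := ENNReal.mul_div_le

theorem memSchreier_of_finite {x : ℕ → ℂ} (hx : x.support.Finite) : MemSchreier x :=
  fun ε _ => ⟨x, hx, by simp [schreierENorm]⟩

theorem MemSchreier.lt_top {x : ℕ → ℂ} (hx : MemSchreier x) : schreierENorm x < ⊤ := by
  obtain ⟨w, hw, hw'⟩ := hx 1 one_pos
  have h1 : schreierENorm w ≤ ∑ j ∈ hw.toFinset, ‖w j‖ₑ := by
    refine iSup₂_le fun A hA => ?_
    refine Finset.sum_le_sum_of_ne_zero fun j _ hj => ?_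
    simpa using hj
  calc schreierENorm x = schreierENorm ((x - w) + w) := by rw [sub_add_cancel]
    _ ≤ 1 + ∑ j ∈ hw.toFinset, ‖w j‖ₑ := (schreierENorm_add_le _ _).trans (add_le_add hw' h1)
    _ < ⊤ := ENNReal.add_lt_top.2 ⟨ENNReal.one_lt_top, ENNReal.sum_lt_top.2 fun j _ => by simp⟩

/-- The sequences in the 2-convexification of the Schreier space: `|x|²` is in the Schreier
space. -/
def schreierSqSubmodule : Submodule ℂ (ℕ → ℂ) where
  carrier := {x | MemSchreier (absSq x)}
  zero_mem' := memSchreier_of_finite (by simp [absSq, Function.support])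
  add_mem' := by
    intro x y hx hy
    refine ((hx.add hy).smul 2).mono fun j => ?_
    rw [← ofReal_norm, ← ofReal_norm]
    refine ENNReal.ofReal_le_ofReal ?_
    have e : ((2 : ℂ) • (absSq x + absSq y)) j
        = ((2 * (‖x j‖ ^ 2 + ‖y j‖ ^ 2) : ℝ) : ℂ) := by simp [absSq]
    rw [e, absSq, Complex.norm_real, Complex.norm_real, Real.norm_of_nonneg (by positivity),
      Real.norm_of_nonneg (by positivity), Pi.add_apply]
    nlinarith [norm_add_le (x j) (y j), norm_nonneg (x j + y j), sq_nonneg (‖x j‖ - ‖y j‖)]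
  smul_mem' := by
    intro c x hx
    refine (hx.smul ((‖c‖ ^ 2 : ℝ) : ℂ)).mono fun j => le_of_eq ?_
    congr 1
    simp [absSq, mul_pow]

/-- The 2-convexification `𝓢²` of the Schreier space `𝓢`, with the norm `‖ |x|² ‖_𝓢 ^ (1/2)`. -/
def SchreierSq : Type := ↥schreierSqSubmodule

namespace SchreierSq

instance : AddCommGroup SchreierSq := inferInstanceAs (AddCommGroup ↥schreierSqSubmodule)

instance : Module ℂ SchreierSq := inferInstanceAs (Module ℂ ↥schreierSqSubmodule)

/-- The sequence underlying an element of `𝓢²`. -/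
def toSeq : SchreierSq →ₗ[ℂ] (ℕ → ℂ) := schreierSqSubmodule.subtype

noncomputable instance : Norm SchreierSq where
  norm x := √(schreierENorm (absSq x.toSeq)).toReal

theorem toSeq_injective : Function.Injective toSeq := Subtype.val_injective

theorem lt_top (x : SchreierSq) : schreierENorm (absSq x.toSeq) < ⊤ := MemSchreier.lt_top x.2

theorem sum_le (x : SchreierSq) {A : Finset ℕ} (hA : Admissible A) :
    ∑ j ∈ A, ‖x.toSeq j‖ ^ 2 ≤ ‖x‖ ^ 2 := by
  have h1 := ENNReal.toReal_mono x.lt_top.ne (sum_le_schreierENorm (absSq x.toSeq) hA)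
  rw [ENNReal.toReal_sum (by simp)] at h1
  simp only [enorm_absSq, ENNReal.toReal_pow, toReal_enorm] at h1
  exact h1.trans_eq (Real.sq_sqrt ENNReal.toReal_nonneg).symm

theorem norm_le (x : SchreierSq) {r : ℝ} (hr : 0 ≤ r)
    (h : ∀ A, Admissible A → ∑ j ∈ A, ‖x.toSeq j‖ ^ 2 ≤ r ^ 2) : ‖x‖ ≤ r := by
  refine (Real.sqrt_le_left hr).2 ?_
  refine ENNReal.toReal_le_of_le_ofReal (by positivity) (iSup₂_le fun A hA => ?_)
  rw [← ENNReal.ofReal_toReal (a := ∑ j ∈ A, _) (by simp), ENNReal.toReal_sum (by simp)]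
  simp only [enorm_absSq, ENNReal.toReal_pow, toReal_enorm]
  exact ENNReal.ofReal_le_ofReal (h A hA)

theorem coord_le (x : SchreierSq) (j : ℕ) : ‖x.toSeq j‖ ≤ ‖x‖ := by
  have h := x.sum_le (A := {j}) (by simp [Admissible])
  rw [Finset.sum_singleton] at h
  exact (sq_le_sq₀ (norm_nonneg _) (Real.sqrt_nonneg _)).1 h

theorem normedSpaceCore : NormedSpace.Core ℂ SchreierSq where
  norm_nonneg x := Real.sqrt_nonneg _
  norm_smul c x := by
    have e : absSq (c • x).toSeq = ((‖c‖ ^ 2 : ℝ) : ℂ) • absSq x.toSeq := by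
      ext j
      simp [absSq, mul_pow]
    show √_ = _ * √_
    rw [e, schreierENorm_smul, ENNReal.toReal_mul, toReal_enorm, Complex.norm_real,
      Real.norm_of_nonneg (by positivity), Real.sqrt_mul (by positivity),
      Real.sqrt_sq (norm_nonneg c)]
  norm_triangle x y := by
    have hx : 0 ≤ ‖x‖ := Real.sqrt_nonneg _
    have hy : 0 ≤ ‖y‖ := Real.sqrt_nonneg _
    refine (x + y).norm_le (add_nonneg hx hy) fun A hA => ?_
    have h1 : √(∑ j ∈ A, (‖x.toSeq j‖ + ‖y.toSeq j‖) ^ 2)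
        ≤ √(∑ j ∈ A, ‖x.toSeq j‖ ^ 2) + √(∑ j ∈ A, ‖y.toSeq j‖ ^ 2) := by
      have := Real.Lp_add_le A (fun j => ‖x.toSeq j‖) (fun j => ‖y.toSeq j‖) (p := 2) (by norm_num)
      simp only [Real.rpow_two, sq_abs, ← Real.sqrt_eq_rpow] at this
      exact this
    have h2 : √(∑ j ∈ A, ‖x.toSeq j‖ ^ 2) ≤ ‖x‖ := (Real.sqrt_le_left hx).2 (x.sum_le hA)
    have h3 : √(∑ j ∈ A, ‖y.toSeq j‖ ^ 2) ≤ ‖y‖ := (Real.sqrt_le_left hy).2 (y.sum_le hA)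
    calc ∑ j ∈ A, ‖(x + y).toSeq j‖ ^ 2 ≤ ∑ j ∈ A, (‖x.toSeq j‖ + ‖y.toSeq j‖) ^ 2 := by
          refine Finset.sum_le_sum fun j _ => pow_le_pow_left₀ (norm_nonneg _) ?_ 2
          rw [map_add]
          exact norm_add_le _ _
      _ ≤ (‖x‖ + ‖y‖) ^ 2 := (Real.sqrt_le_left (by positivity)).1 (by linarith)
  norm_eq_zero_iff x := by
    constructor
    · intro h
      apply toSeq_injective
      ext j
      have := x.coord_le j
      rw [h] at this
      simpa using this
    · rintro rfl
      refine le_antisymm (norm_le _ le_rfl fun A _ => by simp) (Real.sqrt_nonneg _)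

noncomputable instance : NormedAddCommGroup SchreierSq := NormedAddCommGroup.ofCore normedSpaceCore

noncomputable instance : NormedSpace ℂ SchreierSq := NormedSpace.ofCore normedSpaceCore

/-- The inclusion of `𝓢²` into the space of all sequences. -/
noncomputable def inclusion : SchreierSq →L[ℂ] (ℕ → ℂ) where
  toLinearMap := toSeq
  cont := continuous_pi fun j =>
    (LinearMap.mkContinuous ((LinearMap.proj j).comp toSeq) 1
      (fun x => by simpa using x.coord_le j)).continuous

/-- The unit vector `e_j` in `𝓢²`. -/
noncomputable def basisVec (j : ℕ) : SchreierSq :=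
  ⟨Pi.single j 1, memSchreier_of_finite ((Set.finite_singleton j).subset fun i hi => by
    by_contra hne
    simp [absSq, Pi.single_eq_of_ne (show i ≠ j from hne)] at hi)⟩

/-- The dual of `𝓢²` as a space of sequences: a functional `φ` corresponds to the sequence
`(φ(e_j))_j`. -/
noncomputable def dualInclusion : StrongDual ℂ SchreierSq →L[ℂ] (ℕ → ℂ) :=
  ContinuousLinearMap.pi fun j => ContinuousLinearMap.apply ℂ ℂ (basisVec j)

end SchreierSq

/-- The space `Z(𝓢²)`, the derived space of `(𝓢², (𝓢²)*)_{1/2}`. -/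
abbrev ZSchreierSq : Type :=
  DerivedSpace SchreierSq.inclusion SchreierSq.dualInclusion

/-- The normalized dyadic blocks: with coordinates counted from `1`, the block with index `n`
(counted from `0`) is `2^{-n/2}` times the indicator function of `{2^n, …, 2^{n+1} - 1}`. -/
noncomputable def dyadicBlock (n : ℕ) : ℕ → ℂ := fun j =>
  if 2 ^ n ≤ j + 1 ∧ j + 1 < 2 ^ (n + 1) then (((√(2 ^ n))⁻¹ : ℝ) : ℂ) else 0

/-! ### The Kalton–Peck space -/

/-- The norm of a sequence in `ℓ₂` (only used for square summable sequences). -/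
noncomputable def l2norm (x : ℕ → ℂ) : ℝ := √(∑' j, ‖x j‖ ^ 2)

/-- The Kalton–Peck map `y ↦ y log (|y| / ‖y‖)`, with `0 log 0 = 0`; it is homogeneous and
equals `y log |y|` on vectors of norm one. -/
noncomputable def kpMap (y : ℕ → ℂ) : ℕ → ℂ := fun j => y j * (Real.log (‖y j‖ / l2norm y) : ℂ)

theorem norm_mul_log_le {t : ℂ} (ht : ‖t‖ ≤ 2) : ‖t * (Real.log ‖t‖ : ℂ)‖ ≤ 2 := by
  rw [norm_mul, Complex.norm_real, Real.norm_eq_abs]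
  rcases eq_or_ne t 0 with rfl | h0
  · simp
  have hpos : 0 < ‖t‖ := norm_pos_iff.2 h0
  rcases le_total ‖t‖ 1 with h1 | h1
  · have := Real.abs_log_mul_self_lt ‖t‖ hpos h1
    rw [abs_mul, abs_of_pos hpos, mul_comm] at this
    linarith
  · rw [abs_of_nonneg (Real.log_nonneg h1)]
    nlinarith [Real.log_le_sub_one_of_pos hpos, Real.log_nonneg h1]

/-- Quasi-additivity of `t ↦ t log |t|`. -/
theorem norm_log_add_le (a b : ℂ) :
    ‖(a + b) * (Real.log ‖a + b‖ : ℂ) - a * (Real.log ‖a‖ : ℂ) - b * (Real.log ‖b‖ : ℂ)‖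
      ≤ 6 * (‖a‖ + ‖b‖) := by
  set m : ℝ := ‖a‖ + ‖b‖ with hm
  have hm0 : 0 ≤ m := by positivity
  rcases hm0.eq_or_lt with h0 | h0
  · have ha : a = 0 := norm_le_zero_iff.1 (by linarith [norm_nonneg b])
    have hb : b = 0 := norm_le_zero_iff.1 (by linarith [norm_nonneg a])
    simp [ha, hb, ← h0]
  have hmc : (m : ℂ) ≠ 0 := by exact_mod_cast h0.ne'
  have key : ∀ t : ℂ, ‖t‖ ≤ 2 * m →
      ∃ r : ℂ, ‖r‖ ≤ 2 ∧ t * (Real.log ‖t‖ : ℂ) = m * r + t * (Real.log m : ℂ) := by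
    intro t ht
    have hn : ‖t / (m : ℂ)‖ = ‖t‖ / m := by
      rw [norm_div, Complex.norm_real, Real.norm_of_nonneg hm0]
    refine ⟨t / m * (Real.log ‖t / (m : ℂ)‖ : ℂ), norm_mul_log_le ?_, ?_⟩
    · rw [hn, div_le_iff₀ h0]
      exact ht
    · rcases eq_or_ne t 0 with rfl | ht0
      · simp
      · rw [hn, Real.log_div (norm_ne_zero_iff.2 ht0) h0.ne']
        push_cast
        field_simp
        ring
  obtain ⟨r, hr, er⟩ := key (a + b) ((norm_add_le a b).trans (by linarith))
  obtain ⟨s, hs, es⟩ := key a (by linarith [norm_nonneg a, norm_nonneg b])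
  obtain ⟨u, hu, eu⟩ := key b (by linarith [norm_nonneg a, norm_nonneg b])
  have e : (a + b) * (Real.log ‖a + b‖ : ℂ) - a * (Real.log ‖a‖ : ℂ) - b * (Real.log ‖b‖ : ℂ)
      = m * (r - s - u) := by
    rw [er, es, eu]
    ring
  rw [e, norm_mul, Complex.norm_real, Real.norm_of_nonneg hm0, mul_comm]
  refine mul_le_mul_of_nonneg_right ?_ hm0
  linarith [norm_sub_le (r - s) u, norm_sub_le r s]

theorem l2norm_pos {y : ℕ → ℂ} (hy : Memℓp y 2) {j : ℕ} (h : y j ≠ 0) : 0 < l2norm y := by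
  have hs : Summable fun j => ‖y j‖ ^ 2 := by simpa using hy.summable (by norm_num)
  refine Real.sqrt_pos.2 (hs.tsum_pos (fun _ => by positivity) j ?_)
  have := norm_pos_iff.2 h
  positivity

theorem kpMap_eq {y : ℕ → ℂ} (hy : Memℓp y 2) (j : ℕ) :
    kpMap y j = y j * (Real.log ‖y j‖ : ℂ) - (Real.log (l2norm y) : ℂ) * y j := by
  rcases eq_or_ne (y j) 0 with h | h
  · simp [kpMap, h]
  · rw [kpMap, Real.log_div (norm_ne_zero_iff.2 h) (l2norm_pos hy h).ne']
    push_cast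
    ring

theorem kpMap_add {y w : ℕ → ℂ} (hy : Memℓp y 2) (hw : Memℓp w 2) :
    Memℓp (kpMap (y + w) - kpMap y - kpMap w) 2 := by
  have h1 : Memℓp (fun j => (y j + w j) * (Real.log ‖y j + w j‖ : ℂ)
      - y j * (Real.log ‖y j‖ : ℂ) - w j * (Real.log ‖w j‖ : ℂ)) 2 := by
    have hn : Memℓp (fun j => (6 : ℝ) * (‖y j‖ + ‖w j‖)) 2 :=
      Memℓp.const_smul ((memℓp_norm_iff.2 hy).add (memℓp_norm_iff.2 hw)) (6 : ℝ)
    refine memℓp_gen (Summable.of_nonneg_of_le (fun _ => by positivity) (fun j => ?_)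
      (hn.summable (by norm_num)))
    refine Real.rpow_le_rpow (norm_nonneg _) ?_ (by norm_num)
    exact (norm_log_add_le _ _).trans (le_abs_self _)
  have h2 := ((h1.sub ((hy.add hw).const_smul (Real.log (l2norm (y + w)) : ℂ))).add
    (hy.const_smul (Real.log (l2norm y) : ℂ))).add (hw.const_smul (Real.log (l2norm w) : ℂ))
  convert h2 using 1
  ext j
  simp only [Pi.sub_apply, Pi.add_apply, Pi.smul_apply, smul_eq_mul, kpMap_eq (hy.add hw),
    kpMap_eq hy, kpMap_eq hw]
  ring

theorem l2norm_smul (c : ℂ) (y : ℕ → ℂ) : l2norm (c • y) = ‖c‖ * l2norm y := by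
  simp only [l2norm, Pi.smul_apply, norm_smul, mul_pow, tsum_mul_left]
  rw [Real.sqrt_mul (by positivity), Real.sqrt_sq (norm_nonneg c)]

theorem kpMap_smul (c : ℂ) (y : ℕ → ℂ) : kpMap (c • y) = c • kpMap y := by
  rcases eq_or_ne c 0 with rfl | hc
  · ext j
    simp [kpMap]
  · ext j
    simp only [kpMap, l2norm_smul, Pi.smul_apply, smul_eq_mul, norm_mul,
      mul_div_mul_left _ _ (norm_ne_zero_iff.2 hc), mul_assoc]

/-- The Kalton–Peck space `Z₂`: the couples `(x, y)` of sequences such that `y` and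
`x - Ω(y)` are in `ℓ₂`, where `Ω` is the Kalton–Peck map. -/
def KaltonPeck : Submodule ℂ ((ℕ → ℂ) × (ℕ → ℂ)) where
  carrier := {v | Memℓp v.2 2 ∧ Memℓp (v.1 - kpMap v.2) 2}
  zero_mem' := by
    refine ⟨zero_memℓp, ?_⟩
    have : kpMap (0 : ℕ → ℂ) = 0 := by
      ext j
      simp [kpMap]
    simp only [Prod.fst_zero, Prod.snd_zero, this, sub_zero]
    exact zero_memℓp
  add_mem' := by
    rintro v w ⟨hv, hv'⟩ ⟨hw, hw'⟩
    refine ⟨hv.add hw, ?_⟩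
    convert (hv'.add hw').sub (kpMap_add hv hw) using 1
    ext j
    simp only [Prod.fst_add, Prod.snd_add, Pi.sub_apply, Pi.add_apply]
    ring
  smul_mem' := by
    rintro c v ⟨hv, hv'⟩
    refine ⟨hv.const_smul c, ?_⟩
    convert hv'.const_smul c using 1
    simp only [Prod.smul_fst, Prod.smul_snd, kpMap_smul, smul_sub]

/-- The Kalton–Peck quasi-norm `‖(x, y)‖ = ‖x - Ω(y)‖ + ‖y‖`, which defines the topology of
`Z₂`. -/
noncomputable def kpQuasiNorm (v : KaltonPeck) : ℝ :=
  l2norm (v.1.1 - kpMap v.1.2) + l2norm v.1.2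

end TwistedHilbert

namespace TwistedHilbert

open scoped ENNReal BoundedContinuousFunction
open Filter Topology

/-! ### Block sequences -/

/-! On sequences that are constant on dyadic blocks, `𝓢²` is a copy of `c₀` and its dual a copy of
`ℓ₁`. An admissible set that starts in block `m` has at most `2^(m+1)` elements, and on each of them
`|∑ₙ aₙ uₙ|²` is at most `2^(-m) sup |aₙ|²`. So the problem reduces to the derived space of the
couple `(c₀, ℓ₁)` at `1/2`, which is `Z₂`. The extremal function of `y ∈ ℓ₂` is `yₙ exp ((2z - 1)
log (|yₙ| / ‖y‖))`, and its derivative at `1/2` is `2 Ω(y)`. This is why the embedding is `(x, y) ↦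
(2 ∑ₙ xₙ uₙ, ∑ₙ yₙ uₙ)`.

Upper estimate (`exists_represents_of_kaltonPeck`). On the line `Re z = 0` the extremal function has
constant modulus `‖y‖` on the support of `y`, so it need not take values in `c₀`. A weight `sₙ → ∞`
placed inside the logarithm makes it null there, keeps it summable on `Re z = 1`, and changes the
derivative by an element of `ℓ₂` only. Couples `(x, 0)` come from a scalar factor that vanishes at
`1/2`.

Lower estimate (`kaltonPeck_of_represents`). Pairing `F` with the blocks gives scalar functions that
are bounded in `ℓ_∞` on the left and in `ℓ₁` on the right. Their values at `1/2` are tested against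
reflected extremal functions, which gives the `ℓ₂` bound by duality. After the extremal function of
`y` is subtracted, the value at `1/2` is zero, and the same pairing with Cauchy's estimate bounds `x
- Ω(y)`.

Range. The lower estimate shows that every block couple in `Z(𝓢²)` comes from `Z₂`, and being a
block sequence is a pointwise closed condition, so the range is closed. Tails of elements of `Z₂`
tend to zero, so finite combinations of the given vectors are dense in it. -/

/-- The sequence `∑ₙ aₙ uₙ`, where `uₙ` are the normalized dyadic blocks. -/
noncomputable def blockSum : (ℕ → ℂ) →ₗ[ℂ] (ℕ → ℂ) where
  toFun a j := a (Nat.log 2 (j + 1)) * (((√(2 ^ Nat.log 2 (j + 1)))⁻¹ : ℝ) : ℂ)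
  map_add' a b := by
    ext j
    simp [add_mul]
  map_smul' c a := by
    ext j
    simp [mul_assoc]

theorem blockSum_apply (a : ℕ → ℂ) (j : ℕ) :
    blockSum a j = a (Nat.log 2 (j + 1)) * (((√(2 ^ Nat.log 2 (j + 1)))⁻¹ : ℝ) : ℂ) := rfl

/-- The support of the `n`-th dyadic block. -/
def block (n : ℕ) : Finset ℕ := Finset.Ico (2 ^ n - 1) (2 ^ (n + 1) - 1)

theorem mem_block {n j : ℕ} : j ∈ block n ↔ Nat.log 2 (j + 1) = n := by
  rw [block, Finset.mem_Ico, Nat.log_eq_iff (Or.inr ⟨one_lt_two, Nat.succ_ne_zero j⟩)]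
  have h1 := Nat.one_le_two_pow (n := n)
  have h2 := Nat.one_le_two_pow (n := n + 1)
  omega

theorem card_block (n : ℕ) : (block n).card = 2 ^ n := by
  rw [block, Nat.card_Ico, pow_succ]
  have h1 := Nat.one_le_two_pow (n := n)
  omega

theorem admissible_block (n : ℕ) : Admissible (block n) := by
  intro j hj
  rw [card_block]
  rw [block, Finset.mem_Ico] at hj
  omega

theorem inv_sqrt_sq (n : ℕ) : ((√(2 ^ n))⁻¹ : ℝ) ^ 2 = (2 ^ n)⁻¹ := by
  rw [inv_pow, Real.sq_sqrt (by positivity)]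

theorem blockSum_of_mem {a : ℕ → ℂ} {n j : ℕ} (hj : j ∈ block n) :
    blockSum a j = a n * (((√(2 ^ n))⁻¹ : ℝ) : ℂ) := by
  rw [blockSum_apply, mem_block.1 hj]

theorem dyadicBlock_eq (n : ℕ) : dyadicBlock n = blockSum (Pi.single n 1) := by
  ext j
  have h : (2 ^ n ≤ j + 1 ∧ j + 1 < 2 ^ (n + 1)) ↔ Nat.log 2 (j + 1) = n :=
    (Nat.log_eq_iff (Or.inr ⟨one_lt_two, Nat.succ_ne_zero j⟩)).symm
  rw [dyadicBlock, blockSum_apply]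
  by_cases hn : Nat.log 2 (j + 1) = n
  · rw [if_pos (h.2 hn), hn]
    simp
  · rw [if_neg (fun h' => hn (h.1 h'))]
    simp [hn]

theorem norm_blockSum_sq (a : ℕ → ℂ) (j : ℕ) :
    ‖blockSum a j‖ ^ 2 = ‖a (Nat.log 2 (j + 1))‖ ^ 2 * (2 ^ Nat.log 2 (j + 1))⁻¹ := by
  rw [blockSum_apply, norm_mul, mul_pow, Complex.norm_real, Real.norm_eq_abs, sq_abs, inv_sqrt_sq]

/-- The `c₀` estimate. If the least index `i` of `A` lies in block `m`, admissibility gives `|A| ≤ i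
+ 1 < 2^(m+1)`. Later blocks have smaller coefficients, so each term is at most `M² 2^(-m)`. -/
theorem sum_norm_blockSum_sq_le {a : ℕ → ℂ} {M : ℝ} (ha : ∀ n, ‖a n‖ ≤ M) {A : Finset ℕ}
    (hA : Admissible A) : ∑ j ∈ A, ‖blockSum a j‖ ^ 2 ≤ 2 * M ^ 2 := by
  rcases A.eq_empty_or_nonempty with rfl | hne
  · simp only [Finset.sum_empty]
    positivity
  set i := A.min' hne with hi
  have hcard : (A.card : ℝ) ≤ 2 ^ (Nat.log 2 (i + 1) + 1) := by
    have h1 := hA i (A.min'_mem hne)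
    have h2 := Nat.lt_pow_succ_log_self one_lt_two (i + 1)
    exact_mod_cast h1.trans h2.le
  have hterm : ∀ j ∈ A, ‖blockSum a j‖ ^ 2 ≤ M ^ 2 * (2 ^ Nat.log 2 (i + 1))⁻¹ := by
    intro j hj
    rw [norm_blockSum_sq]
    have h1 : Nat.log 2 (i + 1) ≤ Nat.log 2 (j + 1) :=
      Nat.log_mono_right (Nat.succ_le_succ (A.min'_le j hj))
    have h2 : (2 : ℝ) ^ Nat.log 2 (i + 1) ≤ 2 ^ Nat.log 2 (j + 1) :=
      pow_le_pow_right₀ one_le_two h1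
    gcongr
    exact ha _
  calc ∑ j ∈ A, ‖blockSum a j‖ ^ 2 ≤ A.card • (M ^ 2 * (2 ^ Nat.log 2 (i + 1))⁻¹) :=
        Finset.sum_le_card_nsmul _ _ _ hterm
    _ ≤ 2 ^ (Nat.log 2 (i + 1) + 1) * (M ^ 2 * (2 ^ Nat.log 2 (i + 1))⁻¹) := by
        rw [nsmul_eq_mul]
        gcongr
    _ = 2 * M ^ 2 := by
        rw [pow_succ]
        field_simp

theorem schreierENorm_absSq_blockSum_le {a : ℕ → ℂ} {M : ℝ} (ha : ∀ n, ‖a n‖ ≤ M) :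
    schreierENorm (absSq (blockSum a)) ≤ ENNReal.ofReal (2 * M ^ 2) := by
  refine iSup₂_le fun A hA => ?_
  rw [← ENNReal.ofReal_toReal (a := ∑ j ∈ A, _) (by simp), ENNReal.toReal_sum (by simp)]
  simp only [enorm_absSq, ENNReal.toReal_pow, toReal_enorm]
  exact ENNReal.ofReal_le_ofReal (sum_norm_blockSum_sq_le ha hA)

/-- The Schreier space is the closure of the finitely supported sequences, so boundedness of `a`
would not suffice. Cutting off finitely many blocks leaves a tail with uniformly small coefficients,
to which the `c₀` estimate applies. -/
theorem memSchreier_absSq_blockSum {a : ℕ → ℂ} (ha : Tendsto a atTop (𝓝 0)) :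
    MemSchreier (absSq (blockSum a)) := by
  intro ε hε
  obtain ⟨δ, hδ, hδε⟩ : ∃ δ : ℝ, 0 < δ ∧ ENNReal.ofReal (2 * δ ^ 2) ≤ ε := by
    rcases eq_or_ne ε ⊤ with rfl | h
    · exact ⟨1, one_pos, le_top⟩
    · have hp := ENNReal.toReal_pos hε.ne' h
      refine ⟨√(ε.toReal / 2), by positivity, ENNReal.ofReal_le_of_le_toReal ?_⟩
      rw [Real.sq_sqrt (by positivity)]
      linarith
  obtain ⟨N, hN⟩ := Metric.tendsto_atTop.1 ha δ hδ
  refine ⟨fun j => if Nat.log 2 (j + 1) < N then absSq (blockSum a) j else 0, ?_, ?_⟩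
  · refine (Set.finite_Iio (2 ^ N)).subset fun j hj => ?_
    have h1 : Nat.log 2 (j + 1) < N := by
      by_contra h
      simp [h] at hj
    have h2 := (Nat.log_lt_iff_lt_pow one_lt_two (Nat.succ_ne_zero j)).1 h1
    exact (Nat.lt_succ_self j).trans h2
  · have e : absSq (blockSum a) - (fun j => if Nat.log 2 (j + 1) < N then absSq (blockSum a) j
        else 0) = absSq (blockSum fun n => if n < N then 0 else a n) := by
      ext j
      simp only [Pi.sub_apply, absSq, blockSum_apply]
      split_ifs <;> simp
    rw [e]
    refine (schreierENorm_absSq_blockSum_le fun n => ?_).trans hδε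
    split_ifs with h
    · simpa using hδ.le
    · simpa using (hN n (not_lt.1 h)).le

/-! ### Null sequences in `𝓢²` and summable sequences in its dual -/

namespace SchreierSq

/-- The element `∑ₙ aₙ uₙ` of `𝓢²`, for a null sequence `a`. -/
noncomputable def ofNull (a : ℕ → ℂ) (ha : Tendsto a atTop (𝓝 0)) : SchreierSq :=
  ⟨blockSum a, memSchreier_absSq_blockSum ha⟩

theorem toSeq_ofNull (a : ℕ → ℂ) (ha : Tendsto a atTop (𝓝 0)) :
    (ofNull a ha).toSeq = blockSum a := rfl

theorem norm_le_of_toSeq_eq {x : SchreierSq} {a : ℕ → ℂ} (hx : x.toSeq = blockSum a) {M : ℝ}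
    (ha : ∀ n, ‖a n‖ ≤ M) : ‖x‖ ≤ 2 * M := by
  have hM : 0 ≤ M := (norm_nonneg _).trans (ha 0)
  refine x.norm_le (by positivity) fun A hA => ?_
  rw [hx]
  refine (sum_norm_blockSum_sq_le ha hA).trans ?_
  nlinarith [sq_nonneg M]

/-- The `n`-th dyadic block as an element of `𝓢²`. -/
noncomputable def blockVec (n : ℕ) : SchreierSq :=
  ∑ j ∈ block n, (((√(2 ^ n))⁻¹ : ℝ) : ℂ) • basisVec j

theorem toSeq_basisVec (j : ℕ) : (basisVec j).toSeq = Pi.single j 1 := rfl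

theorem toSeq_blockVec (n : ℕ) : (blockVec n).toSeq = blockSum (Pi.single n 1) := by
  ext i
  rw [blockVec, map_sum, Finset.sum_apply, blockSum_apply]
  simp only [map_smul, toSeq_basisVec, Pi.smul_apply, Pi.single_apply, smul_eq_mul, mul_ite,
    mul_one, mul_zero, Finset.sum_ite_eq, mem_block]
  split_ifs with h
  · rw [h, one_mul]
  · simp

theorem toSeq_sum_smul_blockVec (s : Finset ℕ) (a : ℕ → ℂ) :
    (∑ n ∈ s, a n • blockVec n).toSeq = blockSum fun n => if n ∈ s then a n else 0 := by
  ext i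
  rw [map_sum, Finset.sum_apply, blockSum_apply]
  simp [toSeq_blockVec, blockSum_apply, Pi.single_apply]

/-- Pairing with the `n`-th dyadic block, as a functional on `𝓢²`. -/
noncomputable def blockFun (n : ℕ) : StrongDual ℂ SchreierSq :=
  LinearMap.mkContinuous
    (∑ j ∈ block n, (((√(2 ^ n))⁻¹ : ℝ) : ℂ) • (LinearMap.proj j).comp toSeq) 1 (by
      intro x
      have hc : 0 ≤ (√(2 ^ n) : ℝ)⁻¹ := by positivity
      -- Cauchy–Schwarz on the block, which is itself an admissible set with `2^n` elements; the
      -- normalization `2^(-n/2)` makes the bound exactly 1.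
      have h1 : (∑ j ∈ block n, ‖x.toSeq j‖) ^ 2 ≤ 2 ^ n * ‖x‖ ^ 2 := by
        have h := sq_sum_le_card_mul_sum_sq (s := block n) (f := fun j => ‖x.toSeq j‖)
        rw [card_block] at h
        push_cast at h
        refine h.trans ?_
        gcongr
        exact x.sum_le (admissible_block n)
      rw [one_mul, LinearMap.sum_apply]
      refine (norm_sum_le _ _).trans ?_
      simp only [LinearMap.smul_apply, LinearMap.comp_apply, LinearMap.proj_apply, norm_smul,
        Complex.norm_real, Real.norm_of_nonneg hc, ← Finset.mul_sum]
      refine (sq_le_sq₀ (by positivity) (norm_nonneg _)).1 ?_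
      rw [mul_pow, inv_sqrt_sq]
      calc ((2 : ℝ) ^ n)⁻¹ * (∑ j ∈ block n, ‖x.toSeq j‖) ^ 2
          ≤ (2 ^ n)⁻¹ * (2 ^ n * ‖x‖ ^ 2) := by gcongr
        _ = ‖x‖ ^ 2 := by field_simp)

theorem blockFun_apply (n : ℕ) (x : SchreierSq) :
    blockFun n x = ∑ j ∈ block n, (((√(2 ^ n))⁻¹ : ℝ) : ℂ) * x.toSeq j := by
  simp [blockFun]

theorem norm_blockFun_le (n : ℕ) : ‖blockFun n‖ ≤ 1 :=
  LinearMap.mkContinuous_norm_le _ zero_le_one _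

theorem blockFun_basisVec (n j : ℕ) :
    blockFun n (basisVec j) = blockSum (Pi.single n 1) j := by
  rw [blockFun_apply, toSeq_basisVec, blockSum_apply]
  simp only [Pi.single_apply, mul_ite, mul_one, mul_zero, Finset.sum_ite_eq', mem_block]
  split_ifs with h
  · rw [h, one_mul]
  · simp

theorem dualInclusion_apply (φ : StrongDual ℂ SchreierSq) (j : ℕ) :
    dualInclusion φ j = φ (basisVec j) := rfl

theorem inclusion_apply (x : SchreierSq) : inclusion x = x.toSeq := rfl

/-- The functional `∑ₙ aₙ uₙ` on `𝓢²` for an absolutely summable sequence `a`. -/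
noncomputable def ofSummable (a : ℕ → ℂ) : StrongDual ℂ SchreierSq := ∑' n, a n • blockFun n

theorem norm_smul_blockFun_le (a : ℕ → ℂ) (n : ℕ) : ‖a n • blockFun n‖ ≤ ‖a n‖ := by
  rw [norm_smul]
  exact mul_le_of_le_one_right (norm_nonneg _) (norm_blockFun_le n)

theorem norm_ofSummable_le {a : ℕ → ℂ} (ha : Summable fun n => ‖a n‖) :
    ‖ofSummable a‖ ≤ ∑' n, ‖a n‖ :=
  tsum_of_norm_bounded ha.hasSum (norm_smul_blockFun_le a)

theorem dualInclusion_ofSummable {a : ℕ → ℂ} (ha : Summable fun n => ‖a n‖) :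
    dualInclusion (ofSummable a) = blockSum a := by
  have hs : Summable fun n => a n • blockFun n :=
    Summable.of_norm_bounded ha (norm_smul_blockFun_le a)
  ext j
  rw [dualInclusion_apply, ofSummable]
  have h := ((ContinuousLinearMap.apply ℂ ℂ (basisVec j)).hasSum hs.hasSum).tsum_eq
  simp only [ContinuousLinearMap.apply_apply] at h
  rw [← h, tsum_eq_single (Nat.log 2 (j + 1))]
  · simp [blockFun_basisVec, blockSum_apply]
  · intro n hn
    simp [blockFun_basisVec, blockSum_apply, hn.symm]

end SchreierSq

/-! ### Explicit elements of `𝓕_∞(𝓢², (𝓢²)*)` -/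

/-- A summable family of nonnegative numbers stays summable, with a control of the sum, after
multiplication by a suitable sequence tending to infinity. -/
theorem exists_tendsto_atTop_summable_mul_sq {a : ℕ → ℝ} (h0 : ∀ n, 0 ≤ a n) (ha : Summable a)
    (hA : 0 < ∑' n, a n) :
    ∃ s : ℕ → ℝ, (∀ n, 1 ≤ s n) ∧ Tendsto s atTop atTop ∧
      (Summable fun n => a n * s n ^ 2) ∧ ∑' n, a n * s n ^ 2 ≤ 4 * ∑' n, a n := by
  set A := ∑' n, a n with hAdef
  -- The sequence is padded by a geometric series of sum `A`, so that the remainders `R n` stay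
  -- positive even when `a` is eventually zero. The weight is `s n = (2A / R n)^(1/4)`.
  set b : ℕ → ℝ := fun n => a n + A * (1 / 2 / 2 ^ n) with hb
  have hb0 : ∀ n, 0 < b n := fun n => add_pos_of_nonneg_of_pos (h0 n) (by positivity)
  have hbs : HasSum b (2 * A) := by
    rw [two_mul]
    have h := ha.hasSum.add ((hasSum_geometric_two' 1).mul_left A)
    rwa [mul_one] at h
  set R : ℕ → ℝ := fun n => 2 * A - ∑ k ∈ Finset.range n, b k with hR
  have hRsucc : ∀ n, R n = R (n + 1) + b n := fun n => by
    simp only [hR, Finset.sum_range_succ]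
    ring
  have hRnn : ∀ n, 0 ≤ R n := fun n =>
    sub_nonneg.2 (sum_le_hasSum _ (fun k _ => (hb0 k).le) hbs)
  have hRpos : ∀ n, 0 < R n := fun n => by
    rw [hRsucc]
    exact add_pos_of_nonneg_of_pos (hRnn _) (hb0 n)
  have hRle : ∀ n, R n ≤ 2 * A := fun n =>
    sub_le_self _ (Finset.sum_nonneg fun k _ => (hb0 k).le)
  have hRlim : Tendsto R atTop (𝓝[>] 0) := by
    refine tendsto_nhdsWithin_iff.2 ⟨?_, Eventually.of_forall hRpos⟩
    simpa using (tendsto_const_nhds (x := 2 * A)).sub hbs.tendsto_sum_nat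
  have hsq : ∀ n, √(√(2 * A / R n)) ^ 2 = √(2 * A) / √(R n) := fun n => by
    rw [Real.sq_sqrt (Real.sqrt_nonneg _), Real.sqrt_div (by positivity)]
  -- Telescoping: `a n ≤ R n - R (n + 1)` gives `a n / √(R n) ≤ 2 (√(R n) - √(R (n + 1)))`, and `R 0
  -- = 2A` bounds the total by `4A`.
  have hpart : ∀ n, ∑ k ∈ Finset.range n, a k * √(√(2 * A / R k)) ^ 2
      ≤ 2 * √(2 * A) * (√(2 * A) - √(R n)) := by
    intro n
    induction n with
    | zero => simp [hR]
    | succ n ih =>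
      rw [Finset.sum_range_succ, hsq]
      have hp : 0 < √(R n) := Real.sqrt_pos.2 (hRpos n)
      have hq : √(R (n + 1)) ≤ √(R n) := Real.sqrt_le_sqrt (by linarith [hRsucc n, hb0 n])
      have hab : a n ≤ (√(R n) - √(R (n + 1))) * (2 * √(R n)) := by
        have h1 : a n ≤ b n := le_add_of_nonneg_right (by positivity)
        have h2 := Real.sq_sqrt (hRnn n)
        have h3 := Real.sq_sqrt (hRnn (n + 1))
        nlinarith [hRsucc n, Real.sqrt_nonneg (R (n + 1))]
      have hstep : a n * (√(2 * A) / √(R n)) ≤ 2 * √(2 * A) * (√(R n) - √(R (n + 1))) := by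
        rw [mul_div_assoc', div_le_iff₀ hp]
        nlinarith [mul_le_mul_of_nonneg_right hab (Real.sqrt_nonneg (2 * A))]
      linarith
  have hpart' : ∀ n, ∑ k ∈ Finset.range n, a k * √(√(2 * A / R k)) ^ 2 ≤ 4 * A := by
    intro n
    refine (hpart n).trans ?_
    have h2 := Real.sq_sqrt (show 0 ≤ 2 * A by positivity)
    nlinarith [mul_nonneg (Real.sqrt_nonneg (2 * A)) (Real.sqrt_nonneg (R n))]
  have hnn : ∀ n, 0 ≤ a n * √(√(2 * A / R n)) ^ 2 := fun n => mul_nonneg (h0 n) (sq_nonneg _)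
  refine ⟨fun n => √(√(2 * A / R n)), fun n => ?_, ?_,
    summable_of_sum_range_le hnn hpart', Real.tsum_le_of_sum_range_le hnn hpart'⟩
  · rw [Real.one_le_sqrt, Real.one_le_sqrt, one_le_div (hRpos n)]
    exact hRle n
  · exact Real.tendsto_sqrt_atTop.comp (Real.tendsto_sqrt_atTop.comp
      ((tendsto_inv_nhdsGT_zero.comp hRlim).const_mul_atTop (by positivity : 0 < 2 * A)))

/-- The functions `z ↦ yₙ exp ((2z - 1) ℓₙ)`. -/
noncomputable def expFamily (y : ℕ → ℂ) (l : ℕ → ℝ) (n : ℕ) (z : ℂ) : ℂ :=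
  y n * Complex.exp ((2 * z - 1) * (l n : ℂ))

theorem norm_expFamily (y : ℕ → ℂ) (l : ℕ → ℝ) (n : ℕ) (z : ℂ) :
    ‖expFamily y l n z‖ = ‖y n‖ * Real.exp ((2 * z.re - 1) * l n) := by
  rw [expFamily, norm_mul, Complex.norm_exp]
  congr 2
  simp [Complex.mul_re]

theorem differentiable_expFamily (y : ℕ → ℂ) (l : ℕ → ℝ) (n : ℕ) :
    Differentiable ℂ (expFamily y l n) := by
  unfold expFamily
  fun_prop

theorem expFamily_half (y : ℕ → ℂ) (l : ℕ → ℝ) (n : ℕ) : expFamily y l n (1 / 2) = y n := by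
  simp [expFamily]

theorem hasDerivAt_expFamily (y : ℕ → ℂ) (l : ℕ → ℝ) (n : ℕ) :
    HasDerivAt (expFamily y l n) (2 * (l n : ℂ) * y n) (1 / 2) := by
  have h := ((((hasDerivAt_id (1 / 2 : ℂ)).const_mul 2).sub_const 1).mul_const
    (l n : ℂ)).cexp.const_mul (y n)
  refine HasDerivAt.congr_deriv h ?_
  simp
  ring

theorem norm_expFamily_le (y : ℕ → ℂ) (l : ℕ → ℝ) (n : ℕ) {z : ℂ}
    (hz : z ∈ Complex.re ⁻¹' Set.Icc (0 : ℝ) 1) :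
    ‖expFamily y l n z‖ ≤ ‖y n‖ * Real.exp |l n| := by
  rw [norm_expFamily]
  refine mul_le_mul_of_nonneg_left (Real.exp_le_exp.2 ?_) (norm_nonneg _)
  refine (le_abs_self _).trans ?_
  rw [abs_mul]
  refine mul_le_of_le_one_left (abs_nonneg _) (abs_le.2 ⟨?_, ?_⟩)
  · linarith [hz.1]
  · linarith [hz.2]

namespace SchreierSq

/-- A representation of a pair of block sequences by the function
`z ↦ ∑ₙ φ(z) yₙ exp ((2z - 1) ℓₙ) uₙ`. -/
theorem exists_represents_expFamily {y : ℕ → ℂ} {l : ℕ → ℝ} {K M : ℝ} {φ : ℂ → ℂ}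
    (hφ : Differentiable ℂ φ) (hK : ∀ z ∈ Complex.re ⁻¹' Set.Icc (0 : ℝ) 1, ‖φ z‖ ≤ K)
    (hlim : Tendsto (fun n => ‖y n‖ * Real.exp (-l n)) atTop (𝓝 0))
    (hM₀ : ∀ n, ‖y n‖ * Real.exp (-l n) ≤ M)
    (hsum : Summable fun n => ‖y n‖ * Real.exp (l n))
    (hM₁ : ∑' n, ‖y n‖ * Real.exp (l n) ≤ M) :
    ∃ F g₀ g₁, Represents inclusion dualInclusion
      (blockSum fun n => deriv φ (1 / 2) * y n + φ (1 / 2) * (2 * (l n : ℂ) * y n),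
        blockSum fun n => φ (1 / 2) * y n) F g₀ g₁ ∧ max ‖g₀‖ ‖g₁‖ ≤ 2 * (K * M) := by
  set G : ℂ → ℕ → ℂ := fun z n => φ z * expFamily y l n z with hG
  have hK0 : 0 ≤ K := (norm_nonneg _).trans (hK 0 (by simp))
  have hM : 0 ≤ M := le_trans (by positivity) (hM₀ 0)
  have hGd : ∀ n, Differentiable ℂ fun z => G z n := fun n =>
    hφ.mul (differentiable_expFamily y l n)
  have hG0 : ∀ (t : ℝ) n, ‖G (t * Complex.I) n‖ ≤ K * (‖y n‖ * Real.exp (-l n)) := by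
    intro t n
    rw [hG, norm_mul, norm_expFamily]
    have h : (2 * ((t : ℂ) * Complex.I).re - 1) * l n = -l n := by simp
    rw [h]
    exact mul_le_mul_of_nonneg_right (hK _ (by simp)) (by positivity)
  have hG1 : ∀ (t : ℝ) n, ‖G (1 + t * Complex.I) n‖ ≤ K * (‖y n‖ * Real.exp (l n)) := by
    intro t n
    rw [hG, norm_mul, norm_expFamily]
    have h : (2 * (1 + (t : ℂ) * Complex.I).re - 1) * l n = l n := by
      simp
      ring
    rw [h]
    exact mul_le_mul_of_nonneg_right (hK _ (by simp)) (by positivity)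
  have hlimK : Tendsto (fun n => K * (‖y n‖ * Real.exp (-l n))) atTop (𝓝 0) := by
    simpa using hlim.const_mul K
  have hnull : ∀ t : ℝ, Tendsto (G (t * Complex.I)) atTop (𝓝 0) := fun t =>
    squeeze_zero_norm (hG0 t) hlimK
  have hsumm : ∀ t : ℝ, Summable fun n => ‖G (1 + t * Complex.I) n‖ := fun t =>
    Summable.of_nonneg_of_le (fun _ => norm_nonneg _) (hG1 t) (hsum.mul_left K)
  have hc0 : Continuous fun t : ℝ => ofNull (G (t * Complex.I)) (hnull t) := by
    -- The left boundary values are uniform limits of finite block sums, because the majorant `K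
    -- |yₙ| exp (-ℓₙ)` is null and does not depend on `t`. This gives norm continuity in `𝓢²`.
    have hu : TendstoUniformly
        (fun (N : ℕ) (t : ℝ) => ∑ n ∈ Finset.range N, G (t * Complex.I) n • blockVec n)
        (fun t : ℝ => ofNull (G (t * Complex.I)) (hnull t)) atTop := by
      rw [Metric.tendstoUniformly_iff]
      intro ε hε
      obtain ⟨N₀, hN₀⟩ := Metric.tendsto_atTop.1 hlimK (ε / 4) (by positivity)
      filter_upwards [eventually_ge_atTop N₀] with N hN t
      rw [dist_eq_norm]
      have hle := norm_le_of_toSeq_eq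
        (x := ofNull (G (t * Complex.I)) (hnull t)
          - ∑ n ∈ Finset.range N, G (t * Complex.I) n • blockVec n)
        (a := fun n => if n < N then 0 else G (t * Complex.I) n) (M := ε / 4) (by
          rw [map_sub, toSeq_ofNull, toSeq_sum_smul_blockVec, ← map_sub]
          congr 1
          ext n
          by_cases h : n < N <;> simp [h]) (by
          intro n
          split_ifs with h
          · simp only [norm_zero]
            positivity
          · have h2 := hN₀ n (hN.trans (not_lt.1 h))
            rw [dist_zero_right] at h2
            exact ((hG0 t n).trans (le_abs_self _)).trans h2.le)
      linarith
    refine hu.continuous (Eventually.frequently (Eventually.of_forall fun N => ?_))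
    refine continuous_finsetSum _ fun n _ => ?_
    have h : Continuous fun t : ℝ => G (t * Complex.I) n :=
      (hGd n).continuous.comp (by fun_prop)
    exact h.smul continuous_const
  have hc1 : Continuous fun t : ℝ => ofSummable (G (1 + t * Complex.I)) := by
    refine continuous_tsum (fun n => ?_) (hsum.mul_left K) fun n t =>
      (norm_smul_blockFun_le _ n).trans (hG1 t n)
    have h : Continuous fun t : ℝ => G (1 + t * Complex.I) n :=
      (hGd n).continuous.comp (by fun_prop)
    exact h.smul continuous_const
  have hb0 : ∀ t : ℝ, ‖ofNull (G (t * Complex.I)) (hnull t)‖ ≤ 2 * (K * M) := fun t =>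
    norm_le_of_toSeq_eq rfl fun n => (hG0 t n).trans (mul_le_mul_of_nonneg_left (hM₀ n) hK0)
  have hb1 : ∀ t : ℝ, ‖ofSummable (G (1 + t * Complex.I))‖ ≤ 2 * (K * M) := fun t => by
    have h1 := (hsumm t).tsum_le_tsum (hG1 t) (hsum.mul_left K)
    rw [tsum_mul_left] at h1
    have h2 := mul_le_mul_of_nonneg_left hM₁ hK0
    have h3 := norm_ofSummable_le (hsumm t)
    have h4 : 0 ≤ K * M := mul_nonneg hK0 hM
    linarith
  refine ⟨fun z => blockSum (G z),
    BoundedContinuousFunction.ofNormedAddCommGroup _ hc0 _ hb0,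
    BoundedContinuousFunction.ofNormedAddCommGroup _ hc1 _ hb1,
    { mem :=
        { continuousOn := ?_
          bounded := ?_
          analytic := ?_
          left := ?_
          right := ?_ }
      value := ?_
      deriv := ?_ },
    max_le (BoundedContinuousFunction.norm_ofNormedAddCommGroup_le _ (by positivity) hb0)
      (BoundedContinuousFunction.norm_ofNormedAddCommGroup_le _ (by positivity) hb1)⟩
  · refine continuousOn_pi.2 fun j => Continuous.continuousOn ?_
    exact (hGd _).continuous.mul continuous_const
  · intro j
    refine ⟨K * (‖y (Nat.log 2 (j + 1))‖ * Real.exp |l (Nat.log 2 (j + 1))|)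
      * ‖(((√(2 ^ Nat.log 2 (j + 1)))⁻¹ : ℝ) : ℂ)‖, fun z hz => ?_⟩
    rw [blockSum_apply, norm_mul, hG, norm_mul]
    gcongr
    · exact hK z hz
    · exact norm_expFamily_le y l _ hz
  · intro j
    exact ((hGd _).mul_const _).differentiableOn
  · intro t
    rfl
  · intro t
    exact (dualInclusion_ofSummable (hsumm t)).symm
  · simp only [hG, expFamily_half]
  · intro j
    have h := (((hφ (1 / 2)).hasDerivAt.mul
      (hasDerivAt_expFamily y l (Nat.log 2 (j + 1)))).mul_const
        (((√(2 ^ Nat.log 2 (j + 1)))⁻¹ : ℝ) : ℂ))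
    rw [expFamily_half] at h
    exact h

end SchreierSq

/-! ### Square summable sequences -/

theorem summable_norm_sq {y : ℕ → ℂ} (hy : Memℓp y 2) : Summable fun n => ‖y n‖ ^ 2 := by
  simpa using hy.summable (by norm_num)

theorem memℓp_of_summable_norm_sq {y : ℕ → ℂ} (hy : Summable fun n => ‖y n‖ ^ 2) :
    Memℓp y 2 :=
  memℓp_gen (by simpa using hy)

theorem l2norm_nonneg (y : ℕ → ℂ) : 0 ≤ l2norm y := Real.sqrt_nonneg _

theorem l2norm_sq (y : ℕ → ℂ) : l2norm y ^ 2 = ∑' n, ‖y n‖ ^ 2 :=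
  Real.sq_sqrt (tsum_nonneg fun _ => sq_nonneg _)

theorem l2norm_eq_norm {y : ℕ → ℂ} (hy : Memℓp y 2) :
    l2norm y = ‖(⟨y, hy⟩ : lp (fun _ : ℕ => ℂ) 2)‖ := by
  rw [lp.norm_eq_tsum_rpow (by norm_num), l2norm, Real.sqrt_eq_rpow]
  simp

theorem l2norm_add_le {y w : ℕ → ℂ} (hy : Memℓp y 2) (hw : Memℓp w 2) :
    l2norm (y + w) ≤ l2norm y + l2norm w := by
  rw [l2norm_eq_norm hy, l2norm_eq_norm hw, l2norm_eq_norm (hy.add hw)]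
  exact norm_add_le (⟨y, hy⟩ : lp (fun _ : ℕ => ℂ) 2) ⟨w, hw⟩

theorem sum_norm_sq_le {y : ℕ → ℂ} (hy : Memℓp y 2) (s : Finset ℕ) :
    ∑ n ∈ s, ‖y n‖ ^ 2 ≤ l2norm y ^ 2 := by
  rw [l2norm_sq]
  exact (summable_norm_sq hy).sum_le_tsum s fun _ _ => sq_nonneg _

theorem memℓp_and_l2norm_le {y : ℕ → ℂ} {M : ℝ} (hM : 0 ≤ M)
    (h : ∀ N, ∑ n ∈ Finset.range N, ‖y n‖ ^ 2 ≤ M ^ 2) : Memℓp y 2 ∧ l2norm y ≤ M :=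
  ⟨memℓp_of_summable_norm_sq (summable_of_sum_range_le (fun _ => sq_nonneg _) h),
    (Real.sqrt_le_left hM).2 (Real.tsum_le_of_sum_range_le (fun _ => sq_nonneg _) h)⟩

theorem norm_le_l2norm {y : ℕ → ℂ} (hy : Memℓp y 2) (n : ℕ) : ‖y n‖ ≤ l2norm y := by
  have h := sum_norm_sq_le hy {n}
  rw [Finset.sum_singleton] at h
  exact (sq_le_sq₀ (norm_nonneg _) (l2norm_nonneg _)).1 h

theorem eq_zero_of_l2norm_eq_zero {y : ℕ → ℂ} (hy : Memℓp y 2) (h : l2norm y = 0) : y = 0 :=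
  funext fun n => norm_le_zero_iff.1 (h ▸ norm_le_l2norm hy n)

/-- Logarithmic weights `ℓₙ`, close to `log (|yₙ| / ‖y‖)`, which make
`yₙ exp (-ℓₙ)` a null sequence and `yₙ exp (ℓₙ)` summable. -/
theorem exists_log_weights {y : ℕ → ℂ} (hy : Memℓp y 2) :
    ∃ l : ℕ → ℝ, Tendsto (fun n => ‖y n‖ * Real.exp (-l n)) atTop (𝓝 0) ∧
      (∀ n, ‖y n‖ * Real.exp (-l n) ≤ 4 * l2norm y) ∧
      (Summable fun n => ‖y n‖ * Real.exp (l n)) ∧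
      ∑' n, ‖y n‖ * Real.exp (l n) ≤ 4 * l2norm y ∧
      Memℓp (kpMap y - fun n => (l n : ℂ) * y n) 2 ∧
      l2norm (kpMap y - fun n => (l n : ℂ) * y n) ≤ 2 * l2norm y := by
  rcases (l2norm_nonneg y).eq_or_lt with h0 | hpos
  · obtain rfl := eq_zero_of_l2norm_eq_zero hy h0.symm
    have hz : (kpMap (0 : ℕ → ℂ) - fun n => ((0 : ℝ) : ℂ) * (0 : ℕ → ℂ) n) = 0 := by
      ext n
      simp [kpMap]
    refine ⟨fun _ => 0, ?_⟩
    rw [hz, ← h0]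
    exact ⟨by simp, by simp, by simp, by simp, zero_memℓp, by simp⟩
  -- With `ℓₙ = log (|yₙ| sₙ / ‖y‖)` the left values have modulus at most `‖y‖ / sₙ → 0`, and the
  -- right ones at most `|yₙ|² sₙ² / ‖y‖`. Where `yₙ = 0` the default `log 0 = 0` is harmless, since
  -- `yₙ` is a factor.
  obtain ⟨s, hs1, hslim, hss, hsle⟩ := exists_tendsto_atTop_summable_mul_sq
    (fun n => sq_nonneg ‖y n‖) (summable_norm_sq hy) (by rw [← l2norm_sq]; positivity)
  rw [← l2norm_sq] at hsle
  set L := l2norm y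
  have hspos : ∀ n, 0 < s n := fun n => one_pos.trans_le (hs1 n)
  have hneg : ∀ n, ‖y n‖ * Real.exp (-Real.log (‖y n‖ * s n / L)) ≤ L / s n := by
    intro n
    rcases eq_or_ne (y n) 0 with hy0 | hy0
    · simp only [hy0, norm_zero, zero_mul]
      exact (div_pos hpos (hspos n)).le
    · have hp := norm_pos_iff.2 hy0
      have := hspos n
      rw [Real.exp_neg, Real.exp_log (by positivity)]
      refine le_of_eq ?_
      field_simp
  have hposi : ∀ n, ‖y n‖ * Real.exp (Real.log (‖y n‖ * s n / L)) ≤ ‖y n‖ ^ 2 * s n ^ 2 / L := by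
    intro n
    rcases eq_or_ne (y n) 0 with hy0 | hy0
    · simp [hy0]
    · have hp := norm_pos_iff.2 hy0
      have := hspos n
      rw [Real.exp_log (by positivity), mul_div_assoc']
      refine (div_le_div_iff_of_pos_right hpos).2 ?_
      nlinarith [hs1 n, mul_nonneg (mul_pos hp hp).le (mul_nonneg this.le
        (sub_nonneg.2 (hs1 n)))]
  have hsum : Summable fun n => ‖y n‖ * Real.exp (Real.log (‖y n‖ * s n / L)) :=
    Summable.of_nonneg_of_le (fun n => by positivity) hposi (hss.div_const L)
  have hkp : ∀ n, ‖(kpMap y - fun n => (Real.log (‖y n‖ * s n / L) : ℂ) * y n) n‖ ^ 2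
      ≤ ‖y n‖ ^ 2 * s n ^ 2 := by
    intro n
    rcases eq_or_ne (y n) 0 with hy0 | hy0
    · simp [kpMap, hy0]
    · have hp := norm_pos_iff.2 hy0
      -- The cost of the weight is `yₙ log sₙ`, which is square summable since `0 ≤ log sₙ ≤ sₙ`.
      have e : (kpMap y - fun n => (Real.log (‖y n‖ * s n / L) : ℂ) * y n) n
          = -(y n * (Real.log (s n) : ℂ)) := by
        have h1 : ‖y n‖ * s n / L = ‖y n‖ / L * s n := by ring
        rw [Pi.sub_apply, kpMap, h1, Real.log_mul (div_pos hp hpos).ne' (hspos n).ne']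
        push_cast
        ring
      rw [e, norm_neg, norm_mul, mul_pow, Complex.norm_real,
        Real.norm_of_nonneg (Real.log_nonneg (hs1 n))]
      have := Real.log_nonneg (hs1 n)
      gcongr
      linarith [Real.log_le_sub_one_of_pos (hspos n)]
  have hkps := Summable.of_nonneg_of_le (fun n => sq_nonneg _) hkp hss
  refine ⟨fun n => Real.log (‖y n‖ * s n / L), ?_, ?_, hsum, ?_,
    memℓp_of_summable_norm_sq hkps, ?_⟩
  · exact squeeze_zero (fun n => by positivity) hneg (hslim.const_div_atTop L)
  · intro n
    refine (hneg n).trans ((div_le_self hpos.le (hs1 n)).trans ?_)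
    linarith
  · refine (hsum.tsum_le_tsum hposi (hss.div_const L)).trans ?_
    rw [tsum_div_const, div_le_iff₀ hpos]
    linarith
  · refine (Real.sqrt_le_left (by positivity)).2 ((hkps.tsum_le_tsum hkp hss).trans ?_)
    linarith

/-! ### The upper estimate -/

namespace SchreierSq

/-- The first coordinate cannot be prescribed exactly, because of the weights; `w` is the perturbed
Kalton–Peck map, and its distance to `Ω(y)` is what remains to be corrected. -/
theorem exists_represents_snd {y : ℕ → ℂ} (hy : Memℓp y 2) :
    ∃ w : ℕ → ℂ, Memℓp (kpMap y - w) 2 ∧ l2norm (kpMap y - w) ≤ 2 * l2norm y ∧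
      ∃ F g₀ g₁, Represents inclusion dualInclusion
        (blockSum ((2 : ℂ) • w), blockSum y) F g₀ g₁ ∧ max ‖g₀‖ ‖g₁‖ ≤ 8 * l2norm y := by
  obtain ⟨l, hlim, hM₀, hsum, hM₁, hmem, hle⟩ := exists_log_weights hy
  obtain ⟨F, g₀, g₁, hF, hb⟩ := exists_represents_expFamily (φ := fun _ => 1) (K := 1)
    (differentiable_const _) (fun z _ => by simp) hlim hM₀ hsum hM₁
  refine ⟨fun n => (l n : ℂ) * y n, hmem, hle, F, g₀, g₁, ?_, by linarith⟩
  convert hF using 3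
  · ext n
    simp
    ring
  · simp

/-- A scalar factor `φ` with `φ(1/2) = 0` and `φ'(1/2) = 1` turns a function with value `y` at `1/2`
into one with value `0` and derivative `y`. -/
theorem exists_represents_fst {y : ℕ → ℂ} (hy : Memℓp y 2) :
    ∃ F g₀ g₁, Represents inclusion dualInclusion (blockSum y, 0) F g₀ g₁ ∧
      max ‖g₀‖ ‖g₁‖ ≤ 32 * l2norm y := by
  obtain ⟨l, hlim, hM₀, hsum, hM₁, -⟩ := exists_log_weights hy
  have hd : HasDerivAt (fun z : ℂ => Complex.exp (z - 1 / 2) - 1) 1 (1 / 2) := by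
    have h := ((hasDerivAt_id (1 / 2 : ℂ)).sub_const (1 / 2)).cexp.sub_const 1
    simpa using h
  -- The factor `z - 1/2` is unbounded on the strip, hence the exponential; `|φ| ≤ e + 1 < 4` there.
  obtain ⟨F, g₀, g₁, hF, hb⟩ := exists_represents_expFamily
    (φ := fun z => Complex.exp (z - 1 / 2) - 1) (K := 4)
    (by fun_prop) (fun z hz => by
      refine (norm_sub_le _ _).trans ?_
      rw [Complex.norm_exp, norm_one]
      have h1 : (z - 1 / 2).re ≤ 1 := by
        simp
        linarith [hz.2]
      linarith [Real.exp_le_exp.2 h1, Real.exp_one_lt_d9]) hlim hM₀ hsum hM₁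
  refine ⟨F, g₀, g₁, ?_, by linarith⟩
  convert hF using 2
  · congr 1
    ext n
    rw [hd.deriv]
    simp
  · rw [← map_zero blockSum]
    congr 1
    ext n
    simp

/-- The upper estimate: couples `(2x, y)` with `(x, y)` in the Kalton–Peck space are represented
with a control of the norm. -/
theorem exists_represents_of_kaltonPeck {x y : ℕ → ℂ} (hy : Memℓp y 2)
    (hx : Memℓp (x - kpMap y) 2) :
    ∃ F g₀ g₁, Represents inclusion dualInclusion (blockSum ((2 : ℂ) • x), blockSum y) F g₀ g₁ ∧
      max ‖g₀‖ ‖g₁‖ ≤ 136 * (l2norm (x - kpMap y) + l2norm y) := by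
  obtain ⟨w, hw, hwle, F, g₀, g₁, hF, hb⟩ := exists_represents_snd hy
  obtain ⟨G, h₀, h₁, hG, hb'⟩ := exists_represents_fst ((hx.add hw).const_smul (2 : ℂ))
  have hn := l2norm_add_le hx hw
  rw [l2norm_smul, Complex.norm_ofNat] at hb'
  refine ⟨F + G, g₀ + h₀, g₁ + h₁, ?_, ?_⟩
  -- The correction is `2 (x - w) = 2 ((x - Ω(y)) + (Ω(y) - w))`. Its cost is `64 (‖x - Ω(y)‖ + 2
  -- ‖y‖)`, and the `8 ‖y‖` of the first representation brings the coefficient of `‖y‖` to `136`.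
  · convert hF.add hG using 1
    rw [Prod.mk_add_mk, ← map_add, add_zero]
    congr 2
    rw [← smul_add]
    congr 1
    abel
  · have h1 := norm_add_le g₀ h₀
    have h2 := norm_add_le g₁ h₁
    rw [max_le_iff] at hb hb'
    have h3 := l2norm_nonneg (x - kpMap y)
    have h4 := l2norm_nonneg y
    refine max_le (h1.trans ?_) (h2.trans ?_) <;> linarith

end SchreierSq

/-! ### Families of analytic functions on the strip -/

/-- A bounded analytic function on the strip is bounded by its bound on the boundary. -/
theorem norm_le_of_boundary {f : ℂ → ℂ} {M : ℝ}
    (hc : ContinuousOn f (Complex.re ⁻¹' Set.Icc 0 1))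
    (hd : DifferentiableOn ℂ f (Complex.re ⁻¹' Set.Ioo 0 1))
    (hb : ∃ C : ℝ, ∀ z ∈ Complex.re ⁻¹' Set.Icc (0 : ℝ) 1, ‖f z‖ ≤ C)
    (h₀ : ∀ t : ℝ, ‖f (t * Complex.I)‖ ≤ M) (h₁ : ∀ t : ℝ, ‖f (1 + t * Complex.I)‖ ≤ M)
    {z : ℂ} (hz : z ∈ Complex.re ⁻¹' Set.Icc (0 : ℝ) 1) : ‖f z‖ ≤ M := by
  have hcl : closure (Complex.re ⁻¹' Set.Ioo (0 : ℝ) 1) = Complex.re ⁻¹' Set.Icc (0 : ℝ) 1 := by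
    rw [← closure_Ioo (zero_ne_one' ℝ)]
    exact Complex.closure_preimage_re _
  obtain ⟨C, hC⟩ := hb
  refine PhragmenLindelof.vertical_strip (a := 0) (b := 1) ⟨hd, by rwa [hcl]⟩
    ⟨0, by rw [sub_zero, div_one]; exact Real.pi_pos, 0, ?_⟩ (fun w hw => ?_) (fun w hw => ?_)
    hz.1 hz.2
  · refine Asymptotics.IsBigO.of_bound C ?_
    refine eventually_inf_principal.2 (Eventually.of_forall fun w hw => ?_)
    simpa using hC w (Set.preimage_mono Set.Ioo_subset_Icc_self hw)
  · have e : w = (w.im : ℂ) * Complex.I := by apply Complex.ext <;> simp_all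
    rw [e]
    exact h₀ _
  · have e : w = 1 + (w.im : ℂ) * Complex.I := by apply Complex.ext <;> simp_all
    rw [e]
    exact h₁ _

theorem closedBall_half_subset :
    Metric.closedBall (1 / 2 : ℂ) (1 / 4) ⊆ Complex.re ⁻¹' Set.Ioo (0 : ℝ) 1 := by
  intro z hz
  have h1 : |(z - 1 / 2).re| ≤ 1 / 4 :=
    (Complex.abs_re_le_norm _).trans (by simpa [dist_eq_norm] using hz)
  have h2 : (z - 1 / 2).re = z.re - 1 / 2 := by simp
  rw [h2, abs_le] at h1
  constructor <;> linarith [h1.1, h1.2]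

theorem half_mem_strip : (1 / 2 : ℂ) ∈ Complex.re ⁻¹' Set.Icc (0 : ℝ) 1 :=
  Set.preimage_mono Set.Ioo_subset_Icc_self
    (closedBall_half_subset (Metric.mem_closedBall_self (by norm_num)))

/-- Cauchy's estimate on the disc of radius `1/4` about `1/2`, which accounts for the factor 4. -/
theorem norm_deriv_half_le {f : ℂ → ℂ} {M : ℝ} {d : ℂ}
    (hd : DifferentiableOn ℂ f (Complex.re ⁻¹' Set.Ioo 0 1))
    (hM : ∀ z ∈ Complex.re ⁻¹' Set.Icc (0 : ℝ) 1, ‖f z‖ ≤ M) (hf : HasDerivAt f d (1 / 2)) :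
    ‖d‖ ≤ 4 * M := by
  have := Complex.norm_deriv_le_of_forall_mem_sphere_norm_le (c := 1 / 2) (R := 1 / 4)
    (C := M) (f := f) (by norm_num)
    (DifferentiableOn.diffContOnCl (hd.mono
      (Metric.closure_ball_subset_closedBall.trans closedBall_half_subset)))
    (fun z hz => hM z (Set.preimage_mono Set.Ioo_subset_Icc_self
      (closedBall_half_subset (Metric.sphere_subset_closedBall hz))))
  rw [hf.deriv] at this
  linarith

theorem norm_mul_exp_neg_log_le {y : ℂ} {β : ℝ} (h : ‖y‖ ≤ β) :
    ‖y‖ * Real.exp (-Real.log (‖y‖ / β)) ≤ β := by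
  rcases eq_or_ne y 0 with rfl | hy
  · simpa using h
  · have hp := norm_pos_iff.2 hy
    have hβ := hp.trans_le h
    rw [Real.exp_neg, Real.exp_log (by positivity)]
    refine le_of_eq ?_
    field_simp

theorem norm_mul_exp_log_le {y : ℂ} {β : ℝ} (h : ‖y‖ ≤ β) :
    ‖y‖ * Real.exp (Real.log (‖y‖ / β)) ≤ ‖y‖ ^ 2 / β := by
  rcases eq_or_ne y 0 with rfl | hy
  · simp
  · have hp := norm_pos_iff.2 hy
    have hβ := hp.trans_le h
    rw [Real.exp_log (by positivity)]
    refine le_of_eq ?_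
    ring

/-- Families `(fₙ)` of bounded analytic functions on the strip, with boundary values bounded by `M`
in `ℓ_∞` on the left and in `ℓ₁` on the right. -/
structure IsStripFamily (f : ℕ → ℂ → ℂ) (M : ℝ) : Prop where
  continuousOn : ∀ n, ContinuousOn (f n) (Complex.re ⁻¹' Set.Icc 0 1)
  bounded : ∀ n, ∃ C : ℝ, ∀ z ∈ Complex.re ⁻¹' Set.Icc (0 : ℝ) 1, ‖f n z‖ ≤ C
  analytic : ∀ n, DifferentiableOn ℂ (f n) (Complex.re ⁻¹' Set.Ioo 0 1)
  left : ∀ n (t : ℝ), ‖f n (t * Complex.I)‖ ≤ M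
  right : ∀ N (t : ℝ), ∑ n ∈ Finset.range N, ‖f n (1 + t * Complex.I)‖ ≤ M

namespace IsStripFamily

variable {f g : ℕ → ℂ → ℂ} {M M' : ℝ}

theorem nonneg (hf : IsStripFamily f M) : 0 ≤ M := (norm_nonneg _).trans (hf.left 0 0)

theorem sub (hf : IsStripFamily f M) (hg : IsStripFamily g M') :
    IsStripFamily (f - g) (M + M') where
  continuousOn n := (hf.continuousOn n).sub (hg.continuousOn n)
  bounded n := by
    obtain ⟨C, hC⟩ := hf.bounded n
    obtain ⟨D, hD⟩ := hg.bounded n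
    exact ⟨C + D, fun z hz => (norm_sub_le _ _).trans (add_le_add (hC z hz) (hD z hz))⟩
  analytic n := (hf.analytic n).sub (hg.analytic n)
  left n t := (norm_sub_le _ _).trans (add_le_add (hf.left n t) (hg.left n t))
  right N t := (Finset.sum_le_sum fun n _ => norm_sub_le _ _).trans
    (Finset.sum_add_distrib.trans_le (add_le_add (hf.right N t) (hg.right N t)))

/-- The pairing of a strip family with the reflected extremal family of `b`. -/
noncomputable def pairing (f : ℕ → ℂ → ℂ) (b : ℕ → ℂ) (N : ℕ) (z : ℂ) : ℂ :=
  ∑ n ∈ Finset.range N, f n z *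
    expFamily b (fun n => Real.log (‖b n‖ / √(∑ k ∈ Finset.range N, ‖b k‖ ^ 2))) n (1 - z)

theorem differentiableOn_pairing (hf : IsStripFamily f M) (b : ℕ → ℂ) (N : ℕ) :
    DifferentiableOn ℂ (pairing f b N) (Complex.re ⁻¹' Set.Ioo 0 1) := by
  refine DifferentiableOn.fun_sum fun n _ => (hf.analytic n).mul ?_
  exact ((differentiable_expFamily b _ n).comp (by fun_prop)).differentiableOn

/-- The reflection `z ↦ 1 - z` swaps the two boundary lines of the extremal family. The pairing is
therefore an `ℓ_∞`–`ℓ₁` duality on the left and an `ℓ₁`–`ℓ_∞` duality on the right, with bound `M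
‖b‖₂` on both, and the maximum principle carries the bound inside. -/
theorem norm_pairing_le (hf : IsStripFamily f M) (b : ℕ → ℂ) (N : ℕ) {z : ℂ}
    (hz : z ∈ Complex.re ⁻¹' Set.Icc (0 : ℝ) 1) :
    ‖pairing f b N z‖ ≤ M * √(∑ k ∈ Finset.range N, ‖b k‖ ^ 2) := by
  have hM := hf.nonneg
  set β := √(∑ k ∈ Finset.range N, ‖b k‖ ^ 2) with hβ
  set l : ℕ → ℝ := fun n => Real.log (‖b n‖ / β) with hl
  have hββ : ∑ n ∈ Finset.range N, ‖b n‖ ^ 2 / β = β := by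
    rw [← Finset.sum_div, hβ, Real.div_sqrt]
  have hbβ : ∀ n ∈ Finset.range N, ‖b n‖ ≤ β := fun n hn =>
    Real.le_sqrt_of_sq_le (Finset.single_le_sum (f := fun k => ‖b k‖ ^ 2)
      (fun k _ => sq_nonneg _) hn)
  have hrefl : ∀ w ∈ Complex.re ⁻¹' Set.Icc (0 : ℝ) 1,
      1 - w ∈ Complex.re ⁻¹' Set.Icc (0 : ℝ) 1 := fun w hw => by
    simp only [Set.mem_preimage, Complex.sub_re, Complex.one_re, Set.mem_Icc] at hw ⊢
    constructor <;> linarith [hw.1, hw.2]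
  refine norm_le_of_boundary (f := pairing f b N) ?_ (hf.differentiableOn_pairing b N) ?_ ?_ ?_ hz
  · refine continuousOn_finsetSum _ fun n _ => (hf.continuousOn n).mul ?_
    exact ((differentiable_expFamily b l n).continuous.comp (by fun_prop)).continuousOn
  · choose C hC using hf.bounded
    refine ⟨∑ n ∈ Finset.range N, C n * (‖b n‖ * Real.exp |l n|), fun w hw => ?_⟩
    refine norm_sum_le_of_le _ fun n _ => ?_
    rw [norm_mul]
    exact mul_le_mul (hC n w hw) (norm_expFamily_le b l n (hrefl w hw)) (norm_nonneg _)
      ((norm_nonneg _).trans (hC n w hw))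
  · intro t
    rw [← hββ, Finset.mul_sum]
    refine norm_sum_le_of_le _ fun n hn => ?_
    rw [norm_mul]
    refine mul_le_mul (hf.left n t) ?_ (norm_nonneg _) hM
    rw [norm_expFamily]
    have e : (2 * (1 - (t : ℂ) * Complex.I).re - 1) = 1 := by
      simp
      norm_num
    rw [e, one_mul]
    exact norm_mul_exp_log_le (hbβ n hn)
  · intro t
    refine le_trans ?_ (mul_le_mul_of_nonneg_right (hf.right N t) (Real.sqrt_nonneg _))
    rw [Finset.sum_mul]
    refine norm_sum_le_of_le _ fun n hn => ?_
    rw [norm_mul]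
    refine mul_le_mul_of_nonneg_left ?_ (norm_nonneg _)
    rw [norm_expFamily]
    have e : (2 * (1 - (1 + (t : ℂ) * Complex.I)).re - 1) = -1 := by simp
    rw [e, neg_one_mul]
    exact norm_mul_exp_neg_log_le (hbβ n hn)

theorem le_sq_of_le_mul_sqrt {S M : ℝ} (hS : 0 ≤ S) (h : S ≤ M * √S) : S ≤ M ^ 2 := by
  have h1 := Real.sq_sqrt hS
  nlinarith [sq_nonneg (√S - M)]

/-- Duality in `ℓ₂`: with `b` the conjugate of `f(1/2)`, the pairing at `1/2` equals the sum `S` of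
squares, so `S ≤ M √S`. -/
theorem sum_norm_sq_half_le (hf : IsStripFamily f M) (N : ℕ) :
    ∑ n ∈ Finset.range N, ‖f n (1 / 2)‖ ^ 2 ≤ M ^ 2 := by
  have h := hf.norm_pairing_le (fun n => (starRingEnd ℂ) (f n (1 / 2))) N half_mem_strip
  have e : (1 - 1 / 2 : ℂ) = 1 / 2 := by norm_num
  have hS : 0 ≤ ∑ n ∈ Finset.range N, ‖f n (1 / 2)‖ ^ 2 :=
    Finset.sum_nonneg fun _ _ => sq_nonneg _
  simp only [pairing, e, expFamily_half, RCLike.norm_conj, Complex.mul_conj,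
    Complex.normSq_eq_norm_sq] at h
  rw [← Complex.ofReal_sum, Complex.norm_real, Real.norm_of_nonneg hS] at h
  exact le_sq_of_le_mul_sqrt hS h

/-- Since `f(1/2) = 0`, the product rule leaves only `∑ dₙ bₙ` in the derivative of the pairing, and
the derivative of the extremal family plays no role. The choice `bₙ = conj dₙ` makes it the sum of
squares. -/
theorem sum_norm_sq_deriv_half_le (hf : IsStripFamily f M) (h0 : ∀ n, f n (1 / 2) = 0)
    {d : ℕ → ℂ} (hd : ∀ n, HasDerivAt (f n) (d n) (1 / 2)) (N : ℕ) :
    ∑ n ∈ Finset.range N, ‖d n‖ ^ 2 ≤ (4 * M) ^ 2 := by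
  have e : (1 - 1 / 2 : ℂ) = 1 / 2 := by norm_num
  have hS : 0 ≤ ∑ n ∈ Finset.range N, ‖d n‖ ^ 2 := Finset.sum_nonneg fun _ _ => sq_nonneg _
  set b : ℕ → ℂ := fun n => (starRingEnd ℂ) (d n) with hb
  have hder : HasDerivAt (pairing f b N) ((∑ n ∈ Finset.range N, ‖d n‖ ^ 2 : ℝ) : ℂ) (1 / 2) := by
    rw [Complex.ofReal_sum]
    refine HasDerivAt.fun_sum fun n _ => ?_
    have hk : DifferentiableAt ℂ (fun z => expFamily b (fun n => Real.log
        (‖b n‖ / √(∑ k ∈ Finset.range N, ‖b k‖ ^ 2))) n (1 - z)) (1 / 2) :=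
      ((differentiable_expFamily b _ n).comp (by fun_prop)) _
    refine ((hd n).mul hk.hasDerivAt).congr_deriv ?_
    rw [h0, zero_mul, add_zero, e, expFamily_half, hb, Complex.mul_conj,
      Complex.normSq_eq_norm_sq]
  have h := norm_deriv_half_le (hf.differentiableOn_pairing b N)
    (fun z hz => hf.norm_pairing_le b N hz) hder
  rw [Complex.norm_real, Real.norm_of_nonneg hS, ← mul_assoc] at h
  simp only [hb, RCLike.norm_conj] at h
  exact le_sq_of_le_mul_sqrt hS h

end IsStripFamily

/-- Here no weights are needed: a strip family has to be bounded on the left, not null. -/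
theorem isStripFamily_expFamily {y : ℕ → ℂ} (hy : Memℓp y 2) :
    IsStripFamily (expFamily y fun n => Real.log (‖y n‖ / l2norm y)) (l2norm y) where
  continuousOn n := (differentiable_expFamily y _ n).continuous.continuousOn
  bounded n := ⟨_, fun z hz => norm_expFamily_le y _ n hz⟩
  analytic n := (differentiable_expFamily y _ n).differentiableOn
  left n t := by
    rw [norm_expFamily]
    have e : (2 * ((t : ℂ) * Complex.I).re - 1) = -1 := by simp
    rw [e, neg_one_mul]
    exact norm_mul_exp_neg_log_le (norm_le_l2norm hy n)
  right N t := by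
    have hle : ∀ n ∈ Finset.range N, ‖expFamily y (fun n => Real.log (‖y n‖ / l2norm y)) n
        (1 + t * Complex.I)‖ ≤ ‖y n‖ ^ 2 / l2norm y := fun n _ => by
      rw [norm_expFamily]
      have e : (2 * (1 + (t : ℂ) * Complex.I).re - 1) = 1 := by
        simp
        norm_num
      rw [e, one_mul]
      exact norm_mul_exp_log_le (norm_le_l2norm hy n)
    refine (Finset.sum_le_sum hle).trans ?_
    rw [← Finset.sum_div]
    refine div_le_of_le_mul₀ (l2norm_nonneg y) (l2norm_nonneg y) ?_
    rw [← sq]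
    exact sum_norm_sq_le hy _

/-! ### The lower estimate -/

theorem sum_block_mul_blockSum (a : ℕ → ℂ) (n : ℕ) :
    ∑ j ∈ block n, (((√(2 ^ n))⁻¹ : ℝ) : ℂ) * blockSum a j = a n := by
  have h : ∀ j ∈ block n, (((√(2 ^ n))⁻¹ : ℝ) : ℂ) * blockSum a j
      = (((2 ^ n)⁻¹ : ℝ) : ℂ) * a n := fun j hj => by
    rw [blockSum_of_mem hj, ← inv_sqrt_sq]
    push_cast
    ring
  rw [Finset.sum_congr rfl h, Finset.sum_const, card_block, nsmul_eq_mul]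
  push_cast
  field_simp

namespace SchreierSq

/-- The `ℓ₁` estimate is dual to the `c₀` one: test `φ` on `∑ εₙ uₙ`, where the phases `εₙ` align
its values and the norm is at most 2. -/
theorem sum_norm_blockVec_le (φ : StrongDual ℂ SchreierSq) (N : ℕ) :
    ∑ n ∈ Finset.range N, ‖φ (blockVec n)‖ ≤ 2 * ‖φ‖ := by
  set ε : ℕ → ℂ := fun n => (starRingEnd ℂ) (φ (blockVec n)) / ‖φ (blockVec n)‖ with hε
  have hε1 : ∀ n, ‖ε n‖ ≤ 1 := fun n => by
    simp only [hε, norm_div, RCLike.norm_conj, Complex.norm_real, norm_norm]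
    exact div_self_le_one _
  have hεφ : ∀ n, ε n * φ (blockVec n) = (‖φ (blockVec n)‖ : ℂ) := fun n => by
    rcases eq_or_ne (φ (blockVec n)) 0 with h | h
    · simp [h]
    · have h' : (‖φ (blockVec n)‖ : ℂ) ≠ 0 := by simpa using h
      rw [hε, div_mul_eq_mul_div, div_eq_iff h', mul_comm, Complex.mul_conj,
        Complex.normSq_eq_norm_sq]
      push_cast
      ring
  have hx : ‖∑ n ∈ Finset.range N, ε n • blockVec n‖ ≤ 2 * 1 := by
    refine norm_le_of_toSeq_eq (toSeq_sum_smul_blockVec _ ε) fun n => ?_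
    split_ifs
    · exact hε1 n
    · simp
  have hS : 0 ≤ ∑ n ∈ Finset.range N, ‖φ (blockVec n)‖ := Finset.sum_nonneg fun _ _ => norm_nonneg _
  have h := φ.le_opNorm (∑ n ∈ Finset.range N, ε n • blockVec n)
  simp only [map_sum, map_smul, smul_eq_mul, hεφ] at h
  rw [← Complex.ofReal_sum, Complex.norm_real, Real.norm_of_nonneg hS] at h
  nlinarith [norm_nonneg φ]

/-- Pairing with the blocks reduces `F` to the couple `(ℓ_∞, ℓ₁)`, with no assumption that `F` takes
block values away from `1/2`. -/
theorem isStripFamily_of_memF {F : ℂ → ℕ → ℂ} {g₀ : ℝ →ᵇ SchreierSq}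
    {g₁ : ℝ →ᵇ StrongDual ℂ SchreierSq} (h : MemF inclusion dualInclusion F g₀ g₁) :
    IsStripFamily (fun n z => ∑ j ∈ block n, (((√(2 ^ n))⁻¹ : ℝ) : ℂ) * F z j)
      (2 * max ‖g₀‖ ‖g₁‖) where
  continuousOn n := continuousOn_finsetSum _ fun j _ =>
    continuousOn_const.mul ((continuous_apply j).comp_continuousOn h.continuousOn)
  bounded n := by
    choose C hC using h.bounded
    refine ⟨∑ j ∈ block n, ‖(((√(2 ^ n))⁻¹ : ℝ) : ℂ)‖ * C j, fun z hz => ?_⟩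
    refine norm_sum_le_of_le _ fun j _ => ?_
    rw [norm_mul]
    exact mul_le_mul_of_nonneg_left (hC j z hz) (norm_nonneg _)
  analytic n := DifferentiableOn.fun_sum fun j _ => (h.analytic j).const_mul _
  left n t := by
    rw [h.left, inclusion_apply, ← blockFun_apply]
    have h1 := (blockFun n).le_of_opNorm_le (norm_blockFun_le n) (g₀ t)
    have h2 := g₀.norm_coe_le_norm t
    have h3 := le_max_left ‖g₀‖ ‖g₁‖
    linarith [norm_nonneg g₀]
  right N t := by
    have e : ∀ n, ∑ j ∈ block n, (((√(2 ^ n))⁻¹ : ℝ) : ℂ) * F (1 + t * Complex.I) j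
        = g₁ t (blockVec n) := fun n => by
      rw [h.right, blockVec, map_sum]
      simp only [map_smul, smul_eq_mul, dualInclusion_apply]
    simp only [e]
    refine (sum_norm_blockVec_le _ _).trans ?_
    have h2 := g₁.norm_coe_le_norm t
    have h3 := le_max_right ‖g₀‖ ‖g₁‖
    linarith

/-- The lower estimate: if a couple `(2x, y)` of block sequences is in the derived space, then
`(x, y)` is in the Kalton–Peck space, with a control of the quasi-norm. -/
theorem kaltonPeck_of_represents {x y : ℕ → ℂ} {F : ℂ → ℕ → ℂ} {g₀ : ℝ →ᵇ SchreierSq}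
    {g₁ : ℝ →ᵇ StrongDual ℂ SchreierSq} (h : Represents inclusion dualInclusion
      (blockSum ((2 : ℂ) • x), blockSum y) F g₀ g₁) :
    Memℓp y 2 ∧ Memℓp (x - kpMap y) 2 ∧
      l2norm (x - kpMap y) + l2norm y ≤ 10 * max ‖g₀‖ ‖g₁‖ := by
  set r := max ‖g₀‖ ‖g₁‖
  set f : ℕ → ℂ → ℂ := fun n z => ∑ j ∈ block n, (((√(2 ^ n))⁻¹ : ℝ) : ℂ) * F z j with hf
  have hr : 0 ≤ r := le_max_of_le_left (norm_nonneg _)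
  have hfam : IsStripFamily f (2 * r) := isStripFamily_of_memF h.mem
  have hval : ∀ n, f n (1 / 2) = y n := fun n => by
    simp only [hf, h.value]
    exact sum_block_mul_blockSum y n
  have hder : ∀ n, HasDerivAt (f n) (2 * x n) (1 / 2) := fun n => by
    have hd := HasDerivAt.fun_sum fun j (_ : j ∈ block n) =>
      (h.deriv j).const_mul (((√(2 ^ n))⁻¹ : ℝ) : ℂ)
    exact hd.congr_deriv (sum_block_mul_blockSum ((2 : ℂ) • x) n)
  obtain ⟨hy, hyle⟩ : Memℓp y 2 ∧ l2norm y ≤ 2 * r := by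
    refine memℓp_and_l2norm_le (by positivity) fun N => ?_
    simpa only [hval] using hfam.sum_norm_sq_half_le N
  -- Subtracting the extremal family of `y` kills the value at `1/2` and leaves the derivative `2 (x
  -- - Ω(y))`.
  have hsub := hfam.sub (isStripFamily_expFamily hy)
  have hdsub := hsub.sum_norm_sq_deriv_half_le
    (fun n => by rw [Pi.sub_apply, Pi.sub_apply, hval, expFamily_half, sub_self])
    (fun n => (hder n).sub (hasDerivAt_expFamily y _ n))
  -- The difference is a strip family with bound `2r + ‖y‖ ≤ 4r`, so its derivative has norm at most
  -- `16r`; halving gives `8r`.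
  have hx : Memℓp (x - kpMap y) 2 ∧ l2norm (x - kpMap y) ≤ 8 * r := by
    refine memℓp_and_l2norm_le (by positivity) fun N => ?_
    have e : ∀ n, 2 * x n - 2 * (Real.log (‖y n‖ / l2norm y) : ℂ) * y n
        = 2 * (x - kpMap y) n := fun n => by
      rw [Pi.sub_apply, kpMap]
      ring
    have h1 := hdsub N
    simp only [e, norm_mul, mul_pow, ← Finset.mul_sum, Complex.norm_ofNat] at h1
    have h2 := l2norm_nonneg y
    nlinarith
  exact ⟨hy, hx.1, by linarith [hx.2]⟩

end SchreierSq

/-! ### The embedding of the Kalton–Peck space -/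

theorem range_blockSum : Set.range blockSum
    = {x : ℕ → ℂ | ∀ i j, Nat.log 2 (i + 1) = Nat.log 2 (j + 1) → x i = x j} := by
  ext x
  constructor
  · rintro ⟨a, rfl⟩ i j h
    rw [blockSum_apply, blockSum_apply, h]
  · intro h
    refine ⟨fun n => x (2 ^ n - 1) * (√(2 ^ n) : ℝ), funext fun j => ?_⟩
    have hpos := Nat.one_le_two_pow (n := Nat.log 2 (j + 1))
    have h1 : x (2 ^ Nat.log 2 (j + 1) - 1) = x j := h _ _ (by
      rw [Nat.sub_add_cancel hpos, Nat.log_pow one_lt_two])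
    have h2 : (√(2 ^ Nat.log 2 (j + 1)) : ℝ) ≠ 0 := by positivity
    rw [blockSum_apply, h1, mul_assoc, ← Complex.ofReal_mul, mul_inv_cancel₀ h2,
      Complex.ofReal_one, mul_one]

theorem isClosed_range_blockSum : IsClosed (Set.range blockSum) := by
  rw [range_blockSum]
  simp only [Set.ofPred_forall]
  exact isClosed_iInter fun i => isClosed_iInter fun j => isClosed_iInter fun _ =>
    isClosed_eq (continuous_apply i) (continuous_apply j)

namespace DerivedSpace

variable {X₀ X₁ : Type*} [NormedAddCommGroup X₀] [NormedSpace ℂ X₀]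
  [NormedAddCommGroup X₁] [NormedSpace ℂ X₁]
  {ι₀ : X₀ →L[ℂ] (ℕ → ℂ)} {ι₁ : X₁ →L[ℂ] (ℕ → ℂ)}

/-- Coordinates of the value and of the derivative at `1/2` are controlled by every representing
function; letting `ε → 0` passes from nearly optimal functions to the norm. -/
theorem continuous_toPair :
    Continuous (toPair : DerivedSpace ι₀ ι₁ →ₗ[ℂ] (ℕ → ℂ) × (ℕ → ℂ)) := by
  have key : ∀ j, ∃ M : ℝ, ∀ v : DerivedSpace ι₀ ι₁,
      ‖v.toPair.1 j‖ ≤ M * ‖v‖ ∧ ‖v.toPair.2 j‖ ≤ M * ‖v‖ := fun j => by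
    obtain ⟨M, hM, hb⟩ := exists_coord_bound ι₀ ι₁ j
    refine ⟨M, fun v => ?_⟩
    have hlim : Tendsto (fun ε : ℝ => M * (‖v‖ + ε)) (𝓝[>] 0) (𝓝 (M * ‖v‖)) := by
      have h : Continuous fun ε : ℝ => M * (‖v‖ + ε) := by fun_prop
      simpa using (h.tendsto 0).mono_left nhdsWithin_le_nhds
    have hle : ∀ᶠ ε : ℝ in 𝓝[>] 0, ‖v.toPair.1 j‖ ≤ M * (‖v‖ + ε) ∧
        ‖v.toPair.2 j‖ ≤ M * (‖v‖ + ε) := by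
      filter_upwards [self_mem_nhdsWithin] with ε hε
      obtain ⟨F, g₀, g₁, h, hlt⟩ := v.exists_lt (Set.mem_Ioi.1 hε)
      have h4 := mul_le_mul_of_nonneg_left hlt.le hM
      exact ⟨(hb _ _ _ _ h).1.trans h4, (hb _ _ _ _ h).2.trans h4⟩
    exact ⟨ge_of_tendsto hlim (hle.mono fun _ h => h.1),
      ge_of_tendsto hlim (hle.mono fun _ h => h.2)⟩
  choose M hM using key
  refine Continuous.prodMk (f := fun v => (toPair v).1) (g := fun v => (toPair v).2)
    (continuous_pi fun j => ?_) (continuous_pi fun j => ?_)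
  · exact (LinearMap.mkContinuous ((LinearMap.proj j).comp ((LinearMap.fst ℂ _ _).comp toPair))
      (M j) fun v => (hM j v).1).continuous
  · exact (LinearMap.mkContinuous ((LinearMap.proj j).comp ((LinearMap.snd ℂ _ _).comp toPair))
      (M j) fun v => (hM j v).2).continuous

end DerivedSpace

/-- The embedding `(x, y) ↦ (2 ∑ₙ xₙ uₙ, ∑ₙ yₙ uₙ)`. -/
noncomputable def kpEmbedding : KaltonPeck →ₗ[ℂ] ZSchreierSq :=
  LinearMap.codRestrict (derivedSubmodule SchreierSq.inclusion SchreierSq.dualInclusion)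
    (((blockSum.comp ((2 : ℂ) • LinearMap.fst ℂ _ _)).prod
      (blockSum.comp (LinearMap.snd ℂ _ _))).comp KaltonPeck.subtype) fun v => by
        obtain ⟨F, g₀, g₁, h, -⟩ := SchreierSq.exists_represents_of_kaltonPeck v.2.1 v.2.2
        exact ⟨F, g₀, g₁, h⟩

theorem toPair_kpEmbedding (v : KaltonPeck) :
    (kpEmbedding v).toPair = (blockSum ((2 : ℂ) • v.1.1), blockSum v.1.2) := rfl

theorem norm_kpEmbedding_le (v : KaltonPeck) : ‖kpEmbedding v‖ ≤ 136 * kpQuasiNorm v := by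
  obtain ⟨F, g₀, g₁, h, hle⟩ := SchreierSq.exists_represents_of_kaltonPeck v.2.1 v.2.2
  exact (DerivedSpace.norm_le (kpEmbedding v) h).trans hle

theorem kpQuasiNorm_le (v : KaltonPeck) : 1 / 10 * kpQuasiNorm v ≤ ‖kpEmbedding v‖ := by
  refine le_of_forall_pos_le_add fun ε hε => ?_
  obtain ⟨F, g₀, g₁, h, hlt⟩ := (kpEmbedding v).exists_lt hε
  have h1 : kpQuasiNorm v ≤ 10 * max ‖g₀‖ ‖g₁‖ := (SchreierSq.kaltonPeck_of_represents h).2.2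
  linarith

/-- Surjectivity onto the block couples is the qualitative part of the lower estimate: any
representing function forces membership in `Z₂`. -/
theorem range_kpEmbedding : (LinearMap.range kpEmbedding : Set ZSchreierSq)
    = DerivedSpace.toPair ⁻¹' (Set.range blockSum ×ˢ Set.range blockSum) := by
  ext w
  constructor
  · rintro ⟨v, rfl⟩
    exact ⟨⟨_, rfl⟩, ⟨_, rfl⟩⟩
  · rintro ⟨⟨a, ha⟩, ⟨y, hy⟩⟩
    obtain ⟨F, g₀, g₁, h, -⟩ := w.exists_lt one_pos
    have e : w.toPair = (blockSum ((2 : ℂ) • ((2 : ℂ)⁻¹ • a)), blockSum y) := by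
      rw [smul_inv_smul₀ two_ne_zero, ha, hy]
    rw [e] at h
    obtain ⟨h1, h2, -⟩ := SchreierSq.kaltonPeck_of_represents h
    exact ⟨⟨((2 : ℂ)⁻¹ • a, y), h1, h2⟩, DerivedSpace.toPair_injective e.symm⟩

theorem isClosed_range_kpEmbedding : IsClosed (LinearMap.range kpEmbedding : Set ZSchreierSq) := by
  rw [range_kpEmbedding]
  exact (isClosed_range_blockSum.prod isClosed_range_blockSum).preimage
    DerivedSpace.continuous_toPair

/-! ### Density of the finitely supported couples -/

/-- The sequence `a` with its first `N` terms replaced by zero. -/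
def seqTail (N : ℕ) : (ℕ → ℂ) →ₗ[ℂ] (ℕ → ℂ) where
  toFun a n := if n < N then 0 else a n
  map_add' a b := by
    ext n
    by_cases h : n < N <;> simp [h]
  map_smul' c a := by
    ext n
    by_cases h : n < N <;> simp [h]

theorem seqTail_apply (N : ℕ) (a : ℕ → ℂ) (n : ℕ) :
    seqTail N a n = if n < N then 0 else a n := rfl

theorem memℓp_seqTail {a : ℕ → ℂ} (ha : Memℓp a 2) (N : ℕ) : Memℓp (seqTail N a) 2 :=
  memℓp_of_summable_norm_sq (Summable.of_nonneg_of_le (fun _ => sq_nonneg _) (fun n => by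
    rw [seqTail_apply]
    split_ifs
    · simp
    · exact le_rfl) (summable_norm_sq ha))

theorem tendsto_l2norm_seqTail {a : ℕ → ℂ} (ha : Memℓp a 2) :
    Tendsto (fun N => l2norm (seqTail N a)) atTop (𝓝 0) := by
  have e : ∀ N, l2norm (seqTail N a) = √(∑' k, ‖a (k + N)‖ ^ 2) := fun N => by
    rw [l2norm, ← (summable_norm_sq (memℓp_seqTail ha N)).sum_add_tsum_nat_add N,
      Finset.sum_eq_zero fun n hn => by simp [seqTail_apply, Finset.mem_range.1 hn], zero_add]
    simp [seqTail_apply]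
  simp only [e]
  rw [← Real.sqrt_zero]
  exact (Real.continuous_sqrt.tendsto 0).comp (tendsto_sum_nat_add fun n => ‖a n‖ ^ 2)

/-- The Kalton–Peck map commutes with coordinate cut-offs except for its normalization, which
contributes a scalar multiple of the tail. -/
theorem kpMap_seqTail {y : ℕ → ℂ} (hy : Memℓp y 2) (N : ℕ) :
    kpMap (seqTail N y) = seqTail N (kpMap y)
      + ((Real.log (l2norm y) - Real.log (l2norm (seqTail N y)) : ℝ) : ℂ) • seqTail N y := by
  ext n
  rw [kpMap_eq (memℓp_seqTail hy N), Pi.add_apply, Pi.smul_apply, seqTail_apply, seqTail_apply]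
  split_ifs
  · simp
  · rw [kpMap_eq hy, smul_eq_mul]
    push_cast
    ring

theorem seqTail_sub_kpMap {x y : ℕ → ℂ} (hy : Memℓp y 2) (N : ℕ) :
    seqTail N x - kpMap (seqTail N y) = seqTail N (x - kpMap y)
      + ((Real.log (l2norm (seqTail N y)) - Real.log (l2norm y) : ℝ) : ℂ) • seqTail N y := by
  rw [kpMap_seqTail hy, map_sub]
  push_cast
  module

/-- The tail of an element of the Kalton–Peck space. -/
def kpTail (N : ℕ) (v : KaltonPeck) : KaltonPeck :=
  ⟨(seqTail N v.1.1, seqTail N v.1.2), memℓp_seqTail v.2.1 N, by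
    rw [seqTail_sub_kpMap v.2.1]
    exact (memℓp_seqTail v.2.2 N).add ((memℓp_seqTail v.2.1 N).const_smul _)⟩

/-- The normalization error has norm `t |log t - log ‖y‖|` with `t` the norm of the tail of `y`, and
`t log t → 0` as `t → 0`. -/
theorem tendsto_kpQuasiNorm_kpTail (v : KaltonPeck) :
    Tendsto (fun N => kpQuasiNorm (kpTail N v)) atTop (𝓝 0) := by
  obtain ⟨⟨x, y⟩, hy, hx⟩ := v
  have hly := tendsto_l2norm_seqTail hy
  have hlog : Tendsto (fun N => |l2norm (seqTail N y) * Real.log (l2norm (seqTail N y))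
      - l2norm (seqTail N y) * Real.log (l2norm y)|) atTop (𝓝 0) := by
    have h := (((Real.continuous_mul_log.tendsto 0).comp hly).sub
      (hly.mul_const (Real.log (l2norm y)))).abs
    simpa using h
  have hsum := ((tendsto_l2norm_seqTail hx).add hlog).add hly
  rw [add_zero, add_zero] at hsum
  refine squeeze_zero (fun N => add_nonneg (l2norm_nonneg _) (l2norm_nonneg _)) (fun N => ?_) hsum
  refine add_le_add_left ?_ _
  dsimp only [kpTail]
  rw [seqTail_sub_kpMap hy]
  refine (l2norm_add_le (memℓp_seqTail hx N) ((memℓp_seqTail hy N).const_smul _)).trans_eq ?_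
  rw [l2norm_smul, Complex.norm_real, Real.norm_eq_abs, ← mul_sub, abs_mul,
    abs_of_nonneg (l2norm_nonneg (seqTail N y)), mul_comm]

theorem blockSum_sub_seqTail (a : ℕ → ℂ) (N : ℕ) :
    blockSum (a - seqTail N a) = ∑ n ∈ Finset.range N, a n • dyadicBlock n := by
  ext j
  simp only [Finset.sum_apply, Pi.smul_apply, dyadicBlock_eq, blockSum_apply, Pi.sub_apply,
    seqTail_apply, Pi.single_apply, smul_eq_mul, ite_mul, one_mul, zero_mul, mul_ite, mul_zero,
    Finset.sum_ite_eq, Finset.mem_range]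
  split_ifs <;> simp

theorem memℓp_single (n : ℕ) : Memℓp (Pi.single n 1 : ℕ → ℂ) 2 :=
  memℓp_gen (summable_of_ne_finset_zero (s := {n}) fun i hi => by
    simp [Pi.single_eq_of_ne (Finset.notMem_singleton.1 hi)])

theorem kpMap_single (n : ℕ) : kpMap (Pi.single n 1) = 0 := by
  have h : l2norm (Pi.single n 1) = 1 := by
    rw [l2norm, tsum_eq_single n fun i hi => by simp [Pi.single_eq_of_ne hi]]
    simp
  ext j
  rw [kpMap, h]
  rcases eq_or_ne j n with rfl | hj
  · simp
  · simp [Pi.single_eq_of_ne hj]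

theorem kpMap_zero : kpMap 0 = 0 := by
  ext j
  simp [kpMap]

/-- The element of `Z(𝓢²)` given by the couple `(uₙ, 0)`. -/
noncomputable def blockFst (n : ℕ) : ZSchreierSq :=
  kpEmbedding ⟨((2 : ℂ)⁻¹ • Pi.single n 1, 0), zero_memℓp, by
    simpa only [kpMap_zero, sub_zero] using (memℓp_single n).const_smul (2 : ℂ)⁻¹⟩

/-- The element of `Z(𝓢²)` given by the couple `(0, uₙ)`. -/
noncomputable def blockSnd (n : ℕ) : ZSchreierSq :=
  kpEmbedding ⟨(0, Pi.single n 1), memℓp_single n, by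
    simpa only [kpMap_single, sub_zero] using zero_memℓp⟩

theorem toPair_blockFst (n : ℕ) : (blockFst n).toPair = (dyadicBlock n, 0) := by
  rw [blockFst, toPair_kpEmbedding, smul_inv_smul₀ two_ne_zero, map_zero, dyadicBlock_eq]

theorem toPair_blockSnd (n : ℕ) : (blockSnd n).toPair = (0, dyadicBlock n) := by
  rw [blockSnd, toPair_kpEmbedding, smul_zero, map_zero, dyadicBlock_eq]

theorem kpEmbedding_sub_kpTail (N : ℕ) (v : KaltonPeck) :
    kpEmbedding (v - kpTail N v)
      = ∑ n ∈ Finset.range N, ((2 * v.1.1 n) • blockFst n + v.1.2 n • blockSnd n) := by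
  apply DerivedSpace.toPair_injective
  rw [toPair_kpEmbedding, map_sum]
  simp only [map_add, map_smul, toPair_blockFst, toPair_blockSnd]
  refine Prod.ext ?_ ?_
  · rw [Prod.fst_sum]
    simp only [Prod.fst_add, Prod.smul_fst, smul_zero, add_zero, mul_smul, ← Finset.smul_sum]
    rw [← blockSum_sub_seqTail]
    rfl
  · rw [Prod.snd_sum]
    simp only [Prod.snd_add, Prod.smul_snd, smul_zero, zero_add]
    rw [← blockSum_sub_seqTail]
    rfl

theorem tendsto_kpEmbedding_sub_kpTail (v : KaltonPeck) :
    Tendsto (fun N => kpEmbedding (v - kpTail N v)) atTop (𝓝 (kpEmbedding v)) := by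
  have h : Tendsto (fun N => kpEmbedding (kpTail N v)) atTop (𝓝 0) :=
    squeeze_zero_norm (fun N => norm_kpEmbedding_le _)
      (by simpa using (tendsto_kpQuasiNorm_kpTail v).const_mul 136)
  simpa only [map_sub, sub_zero] using tendsto_const_nhds.sub h

/-- One inclusion is density, since an element minus its tail is a finite combination of the given
vectors; the other holds because the range is closed and contains these vectors. -/
theorem range_kpEmbedding_eq_closure :
    LinearMap.range kpEmbedding = (Submodule.span ℂ {w : ZSchreierSq | ∃ n : ℕ,
      w.toPair = (dyadicBlock n, 0) ∨ w.toPair = (0, dyadicBlock n)}).topologicalClosure := by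
  refine le_antisymm ?_ (Submodule.topologicalClosure_minimal _ (Submodule.span_le.2 ?_)
    isClosed_range_kpEmbedding)
  · rintro _ ⟨v, rfl⟩
    refine mem_closure_of_tendsto (tendsto_kpEmbedding_sub_kpTail v)
      (Eventually.of_forall fun N => ?_)
    rw [kpEmbedding_sub_kpTail]
    refine Submodule.sum_mem _ fun n _ => Submodule.add_mem _
      (Submodule.smul_mem _ _ (Submodule.subset_span ⟨n, Or.inl (toPair_blockFst n)⟩))
      (Submodule.smul_mem _ _ (Submodule.subset_span ⟨n, Or.inr (toPair_blockSnd n)⟩))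
  · rintro w ⟨n, hw | hw⟩
    · rw [DerivedSpace.toPair_injective (hw.trans (toPair_blockFst n).symm)]
      exact LinearMap.mem_range_self _ _
    · rw [DerivedSpace.toPair_injective (hw.trans (toPair_blockSnd n).symm)]
      exact LinearMap.mem_range_self _ _

end TwistedHilbert

theorem lemma4p2 :
    (∀ n : ℕ,
      (TwistedHilbert.dyadicBlock n, (0 : ℕ → ℂ)) ∈ TwistedHilbert.derivedSubmodule
        TwistedHilbert.SchreierSq.inclusion TwistedHilbert.SchreierSq.dualInclusion ∧
      ((0 : ℕ → ℂ), TwistedHilbert.dyadicBlock n) ∈ TwistedHilbert.derivedSubmodule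
        TwistedHilbert.SchreierSq.inclusion TwistedHilbert.SchreierSq.dualInclusion) ∧
    ∃ T : TwistedHilbert.KaltonPeck →ₗ[ℂ] TwistedHilbert.ZSchreierSq,
      (∃ c C : ℝ, 0 < c ∧ ∀ v : TwistedHilbert.KaltonPeck,
        c * TwistedHilbert.kpQuasiNorm v ≤ ‖T v‖ ∧ ‖T v‖ ≤ C * TwistedHilbert.kpQuasiNorm v) ∧
      LinearMap.range T = (Submodule.span ℂ {w : TwistedHilbert.ZSchreierSq | ∃ n : ℕ,
        w.toPair = (TwistedHilbert.dyadicBlock n, 0) ∨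
        w.toPair = (0, TwistedHilbert.dyadicBlock n)}).topologicalClosure := by
  refine ⟨fun n => ⟨?_, ?_⟩, TwistedHilbert.kpEmbedding, ⟨1 / 10, 136, by norm_num, fun v =>
    ⟨TwistedHilbert.kpQuasiNorm_le v, TwistedHilbert.norm_kpEmbedding_le v⟩⟩,
    TwistedHilbert.range_kpEmbedding_eq_closure⟩
  · rw [← TwistedHilbert.toPair_blockFst]
    exact (TwistedHilbert.blockFst n).2
  · rw [← TwistedHilbert.toPair_blockSnd]
    exact (TwistedHilbert.blockSnd n).2
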